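/- **Setting.** For integers $d\ge 0$, $L\ge 1$ let $\Lambda=(\mathbb Z/L\mathbb Z)^d$ be the discrete torus; for $x\in\Lambda$ let $|x|$ be the Euclidean length of the representative of $x$ whose coordinates have least absolute value, so that $|x-y|$ is the torus distance. On the bosonic Fock space over $\ell^2(\Lambda)$, with creation and annihilation operators $b_x^\dagger,b_x$ and $n_x=b_x^\dagger b_x$, $N=\sum_x n_x$, consider $$H=\sum_{x,y\in\Lambda}J_{x,y}\,b_x^\dagger b_y+\Phi(\{n_x\}_{x\in\Lambda}),$$ where $J$ is real and symmetric, $\Phi$ is an arbitrary real function, and $H$ commutes with the translations $T_z$, $z\in\Lambda$. Put $\kappa=\sup_x\sum_y|J_{x,y}||x-y|$. Let $\mathcal D_T$ be the set of $\psi\in\mathcal D(H)\cap\mathcal D(N)$ defining a translation-invariant state, i.e. $T_z\psi=\psi$ up to a phase for every $z$. Write $\psi_t=e^{-itH}\psi_0$ and $\langle O\rangle_t=\langle\psi_t,O\psi_t\rangle$ (understood as a quadratic form). For $\varepsilon>0$ let $\mathcal C_\varepsilon$ be the set of $f\in C^\infty(\mathbb R)$ with $f\ge 0$, $f=0$ on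 $(-\infty,\varepsilon/2]$, $f=1$ on $[\varepsilon,\infty)$, $f'\ge 0$, $\sqrt{f'}\in C_c^\infty(\mathbb R)$ and $\operatorname{supp}f'\subset(\varepsilon/2,\varepsilon)$. Given $v>2\kappa$, $R>r>0$ and $t\ge0$, put $\tilde v=\frac{\kappa+v}2$, $s=\frac{R-r}{v}$, $f_{ts}(x)=f\big(\frac{R-\tilde v t-|x|}{s}\big)$, and for $f\in\mathcal C_\varepsilon$ let $$\mathbb A_{ts}[f]=\sum_{x\in\Lambda}f_{ts}(x)\,n_0n_x,\qquad \mathbb A'_{ts}[f]=\sum_{x\in\Lambda}(f')_{ts}(x)\,n_0n_x .$$ **Proposition (Differential inequality).** Let $\alpha>3d+1$, $\beta=\lfloor\alpha-d-1\rfloor$, $C_J\in\mathbb R$, $\varepsilon>0$ and $\chi\in\mathcal C_\varepsilon$. Then there are $C>0$ and $\tilde\chi\in\mathcal C_\varepsilon$, depending only on $\chi,\varepsilon,\alpha,d,C_J$, such that the following holds for all $L$, $J$, $\Phi$ as above with $|J_{x,y}|\le C_J(1+|x-y|)^{-\alpha}$ for all $x,y\in\Lambda$, for every $v>2\kappa$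 with $v-\tilde v=\varepsilon$, every $\psi_0\in\mathcal D_T$, all $R>r>0$ with $R-r>\max\{v,1\}$, and all $t\ge0$: the four expectations below are given by absolutely convergent sums in the occupation number basis, and $$\big\langle\partial_t\mathbb A_{ts}[\chi]+[iH,\mathbb A_{ts}[\chi]]\big\rangle_t\le\frac{2\kappa-\tilde v}{s}\big\langle\mathbb A'_{ts}[\chi]\big\rangle_t+\frac{C}{s^2}\big\langle\mathbb A'_{ts}[\tilde\chi]\big\rangle_t+\frac{C}{s^{\beta+1}}R^d\langle n_0^2\rangle_t .$$ (The left-hand side is understood as its real part.) -/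

import Mathlib

open scoped ContDiff ComplexConjugate

namespace BoseHubbard

noncomputable section

/-- The discrete torus of side length `L` in dimension `d`. -/
abbrev Torus (d L : ℕ) : Type := Fin d → ZMod L

/-- The Euclidean distance of a site of the torus from the origin: each coordinate is represented
by its representative of least absolute value modulo `L`. The torus distance between `x` and `y`
is `siteNorm (x - y)`. -/
def siteNorm {d L : ℕ} (x : Torus d L) : ℝ :=
  Real.sqrt (∑ i, ((x i).valMinAbs : ℝ) ^ 2)

/-- Occupation numbers: `η x` is the number of bosons at the site `x`. -/
abbrev Config (d L : ℕ) : Type := Torus d L → ℕ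

/-- The bosonic Fock space over `ℓ²` of the torus, in the occupation number representation:
`ψ η` is the coefficient of the normalized occupation number vector `|η⟩`. -/
abbrev FockSpace (d L : ℕ) : Type := lp (fun _ : Config d L => ℂ) 2

/-- Operators given by their action on coefficient functions. All operators below have finitely
many nonzero matrix elements in every row of the occupation number basis, so they act on arbitrary
coefficient functions, and products and commutators make sense without any restriction of domain.
The Hilbert space domains are imposed separately, see `InDomain`. -/
abbrev Operator (d L : ℕ) : Type := Module.End ℂ (Config d L → ℂ)

/-- The annihilation operator `b_x`, with `b_x |η⟩ = √(η x) |η - δ_x⟩`. -/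
def annihilation {d L : ℕ} (x : Torus d L) : Operator d L where
  toFun ψ η := (Real.sqrt (η x + 1) : ℂ) * ψ (η + Pi.single x 1)
  map_add' ψ φ := by
    funext η
    simp [mul_add]
  map_smul' c ψ := by
    funext η
    simp [mul_left_comm]

/-- The creation operator `b_x†`, with `b_x† |η⟩ = √(η x + 1) |η + δ_x⟩`. (At configurations with
`η x = 0` the prefactor vanishes, so the truncated subtraction plays no role.) -/
def creation {d L : ℕ} (x : Torus d L) : Operator d L where
  toFun ψ η := (Real.sqrt (η x) : ℂ) * ψ (η - Pi.single x 1)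
  map_add' ψ φ := by
    funext η
    simp [mul_add]
  map_smul' c ψ := by
    funext η
    simp [mul_left_comm]

/-- The local number operator `n_x = b_x† b_x`. -/
def number {d L : ℕ} (x : Torus d L) : Operator d L := creation x * annihilation x

/-- The total number operator. -/
def totalNumber (d L : ℕ) [NeZero L] : Operator d L := ∑ x, number x

/-- The potential `Φ({n_x})`, a real function of the local number operators. -/
def potential {d L : ℕ} (Φ : Config d L → ℝ) : Operator d L where
  toFun ψ η := (Φ η : ℂ) * ψ η
  map_add' ψ φ := by
    funext η
    simp [mul_add]
  map_smul' c ψ := by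
    funext η
    simp [mul_left_comm]

/-- The Hamiltonian `H = ∑_{x,y} J_{x,y} b_x† b_y + Φ({n_x})`. -/
def hamiltonian {d L : ℕ} [NeZero L] (J : Matrix (Torus d L) (Torus d L) ℝ)
    (Φ : Config d L → ℝ) : Operator d L :=
  ∑ x, ∑ y, (J x y : ℂ) • (creation x * annihilation y) + potential Φ

/-- The translation operator `T_z` on Fock space, the second quantization of
`(T_z f) y = f (y + z)`. It is unitary with adjoint `T_{-z}`. -/
def translation {d L : ℕ} (z : Torus d L) : Operator d L :=
  LinearMap.funLeft ℂ ℂ (fun (η : Config d L) y => η (y - z))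

/-- `T_z^* O T_z = O` for all `z`. -/
def IsTranslationInvariantOp {d L : ℕ} (O : Operator d L) : Prop :=
  ∀ z : Torus d L, translation (-z) * O * translation z = O

/-- The vector `ψ` defines a translation-invariant state: every `T_z ψ` equals `ψ`, up to a phase
(which does not change the state). -/
def IsTranslationInvariantState {d L : ℕ} (ψ : FockSpace d L) : Prop :=
  ∀ z : Torus d L, ∃ c : ℂ, ‖c‖ = 1 ∧ translation z (ψ : Config d L → ℂ) = c • ⇑ψ

/-- The maximal domain of an operator: those `ψ` in Fock space with `O ψ` in Fock space. -/
def InDomain {d L : ℕ} (O : Operator d L) (ψ : FockSpace d L) : Prop :=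
  Memℓp (O (ψ : Config d L → ℂ)) 2

/-- The class `𝒟_T` of translation-invariant states in `𝒟(H) ∩ 𝒟(N)`. -/
structure IsAdmissibleState {d L : ℕ} [NeZero L] (H : Operator d L) (ψ : FockSpace d L) :
    Prop where
  mem_domain_hamiltonian : InDomain H ψ
  mem_domain_number : InDomain (totalNumber d L) ψ
  translation_invariant : IsTranslationInvariantState ψ

/-- The configurations with exactly `N` bosons (a finite set). -/
abbrev Sector (d L : ℕ) [NeZero L] (N : ℕ) : Type :=
  ↥(Finset.piAntidiag (Finset.univ : Finset (Torus d L)) N)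

/-- The matrix of an operator on the `N`-boson sector, in the occupation number basis. -/
def sectorMatrix {d L : ℕ} [NeZero L] (O : Operator d L) (N : ℕ) :
    Matrix (Sector d L N) (Sector d L N) ℂ :=
  fun η ξ => O (Pi.single (ξ : Config d L) 1) (η : Config d L)

/-- The time-evolved vector `e^{-itH} ψ`. The Hamiltonian conserves the number of bosons, so it is
the direct sum of its Hermitian matrices `H_N` on the finite-dimensional `N`-boson sectors, and
`e^{-itH}` is the direct sum of the matrix exponentials `e^{-itH_N}`. -/
def evolve {d L : ℕ} [NeZero L] (H : Operator d L) (t : ℝ) (ψ : Config d L → ℂ) :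
    Config d L → ℂ :=
  fun η => (NormedSpace.exp ((-(Complex.I * (t : ℂ))) • sectorMatrix H (∑ x, η x))).mulVec
    (fun ξ => ψ (ξ : Config d L)) ⟨η, by simp⟩

/-- The expectation `⟨ψ, O ψ⟩ = ∑_η conj (ψ η) (O ψ) η`, as a quadratic form. -/
def expectation {d L : ℕ} (ψ : Config d L → ℂ) (O : Operator d L) : ℂ :=
  ∑' η, conj (ψ η) * O ψ η

/-- The sum that defines the expectation converges absolutely. -/
def HasExpectation {d L : ℕ} (ψ : Config d L → ℂ) (O : Operator d L) : Prop :=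
  Summable fun η => conj (ψ η) * O ψ η

/-- The first moment `κ = sup_x ∑_y |J_{x,y}| |x - y|` of the hopping matrix. -/
def kappa {d L : ℕ} [NeZero L] (J : Matrix (Torus d L) (Torus d L) ℝ) : ℝ :=
  ⨆ x, ∑ y, |J x y| * siteNorm (x - y)

/-- The class `𝒞_ε` of cutoff functions. -/
structure IsCutoff (ε : ℝ) (f : ℝ → ℝ) : Prop where
  smooth : ContDiff ℝ ∞ f
  nonneg : ∀ a, 0 ≤ f a
  eq_zero : ∀ a ≤ ε / 2, f a = 0
  eq_one : ∀ a, ε ≤ a → f a = 1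
  deriv_nonneg : ∀ a, 0 ≤ deriv f a
  sqrt_deriv_smooth : ContDiff ℝ ∞ fun a => Real.sqrt (deriv f a)
  sqrt_deriv_compact : HasCompactSupport fun a => Real.sqrt (deriv f a)
  tsupport_deriv : tsupport (deriv f) ⊆ Set.Ioo (ε / 2) ε

/-- The rescaled function `f_{ts}(x) = f ((R - w t - |x|) / s)` on the torus, where `w` is the
speed of the front. -/
def scaled {d L : ℕ} (f : ℝ → ℝ) (R w s t : ℝ) (x : Torus d L) : ℝ :=
  f ((R - w * t - siteNorm x) / s)

/-- The weighted correlation observable `∑_x g(x) n_0 n_x`. -/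
def correlation {d L : ℕ} [NeZero L] (g : Torus d L → ℝ) : Operator d L :=
  ∑ x, (g x : ℂ) • (number 0 * number x)

/-- The correlation observable `𝔸_{ts} = ∑_x χ_{ts}(x) n_0 n_x`. -/
def astlo {d L : ℕ} [NeZero L] (χ : ℝ → ℝ) (R w s t : ℝ) : Operator d L :=
  correlation (scaled χ R w s t)

/-- The derivative `∂_t 𝔸_{ts}` with respect to the explicit time dependence. -/
def astloTimeDeriv {d L : ℕ} [NeZero L] (χ : ℝ → ℝ) (R w s t : ℝ) : Operator d L :=
  correlation fun x => deriv (fun τ => scaled χ R w s τ x) t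

/-- The observable `𝔸'_{ts} = ∑_x (χ')_{ts}(x) n_0 n_x`. -/
def astloPrime {d L : ℕ} [NeZero L] (χ : ℝ → ℝ) (R w s t : ℝ) : Operator d L :=
  correlation (scaled (deriv χ) R w s t)

/-- The Heisenberg derivative `∂_t 𝔸_{ts} + [iH, 𝔸_{ts}]`. -/
def heisenbergDeriv {d L : ℕ} [NeZero L] (H : Operator d L) (χ : ℝ → ℝ) (R w s t : ℝ) :
    Operator d L :=
  astloTimeDeriv χ R w s t + ⁅Complex.I • H, astlo χ R w s t⁆

end

end BoseHubbard

open BoseHubbard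

namespace BoseHubbard

/-! The explicit time derivative of the cutoff yields exactly `-(w / s)` times the derivative
observable, so the task is to bound the commutator by `2 * kappa J / s` times it, up to errors.

Moving one boson changes `n_0 ∑ g(z) n_z` in two ways: through the weighted sum, with coefficient `g
y - g x`, and through `n_0`. The symmetric product rule `correlationValue_sub` separates the two.
Since `g` is even and both the state and the hopping are translation invariant, they have the same
expectation (`IsShiftInvariant.sum_hop_swap`), so everything becomes a sum of `J x y * (g y - g x)`
times the moment of `b_x† b_y` symmetrized with `n_0`. Cauchy–Schwarz bounds that moment by `⟨n_0
n_x⟩ + ⟨n_0 n_y⟩`; the corrections when a hop touches the origin cancel because all sites have the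
same mean occupation (`FiniteSecondMoment.norm_hopMoment_le`).

What remains is a classical transport estimate, `sum_hopping_front_le`. For hops shorter than a
multiple of `s`, the increment of the cutoff is at most its derivative times the displacement, plus
a quadratic error carried by the derivative of a second cutoff (`IsCutoff.exists_abs_sub_le`); the
first moment of `J` gives `kappa J`. Longer hops are rare by the decay of `J`
(`exists_sum_rpow_tail_le`); one end must lie in the ball of radius `R`, and `⟨n_0 n_x⟩ ≤ ⟨n_0²⟩`.

All of this is applied at time `t`: the evolution is unitary on each particle-number sector and
commutes with translations, so it preserves the second moment of `N` and the invariance of the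
state. -/

/-! ### Cutoff functions and their Taylor expansion. -/

/-- A cutoff function whose derivative is bounded below on a prescribed closed ball around the
centre of the transition region. -/
theorem exists_isCutoff_deriv_ge {ε ρ : ℝ} (hρ : 0 < ρ) (hρε : ρ < ε / 4) :
    ∃ f : ℝ → ℝ, IsCutoff ε f ∧ ∃ c : ℝ, 0 < c ∧
      ∀ a ∈ Metric.closedBall (3 * ε / 4) ρ, c ≤ deriv f a := by
  obtain ⟨ρ', hρ', hρ'ε⟩ := exists_between hρε
  -- The outer radius stays below `ε / 4`, so the support is a compact subset of the open transition
  -- interval.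
  let h : ContDiffBump (3 * ε / 4) := ⟨ρ, ρ', hρ, hρ'⟩
  have hcont : Continuous fun a => h a ^ 2 := h.continuous.pow 2
  have hint : ∀ a b, IntervalIntegrable (fun a => h a ^ 2) MeasureTheory.volume a b :=
    fun a b => hcont.intervalIntegrable a b
  have hzero : ∀ a, ρ' ≤ |a - 3 * ε / 4| → h a = 0 := fun a ha =>
    h.zero_of_le_dist (by simpa [Real.dist_eq] using ha)
  set I : ℝ := ∫ a in (ε / 2)..ε, h a ^ 2 with hI
  have hIpos : 0 < I := by
    refine intervalIntegral.integral_pos (by linarith) hcont.continuousOn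
      (fun a _ => sq_nonneg _) ⟨3 * ε / 4, ⟨by linarith, by linarith⟩, ?_⟩
    rw [h.one_of_mem_closedBall (Metric.mem_closedBall_self hρ.le)]
    norm_num
  -- The square of the bump is integrated so that `√f'` is the smooth function `h / √I`.
  let f : ℝ → ℝ := fun b => (∫ a in (ε / 2)..b, h a ^ 2) / I
  have hf : ∀ b, HasDerivAt f (h b ^ 2 / I) b := fun b =>
    (hcont.integral_hasStrictDerivAt (ε / 2) b).hasDerivAt.div_const I
  have hf' : deriv f = fun b => h b ^ 2 / I := funext fun b => (hf b).deriv
  have hsqrt : (fun a => Real.sqrt (deriv f a)) = fun a => h a / Real.sqrt I := by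
    funext a
    rw [hf', Real.sqrt_div (sq_nonneg _), Real.sqrt_sq h.nonneg]
  have hmono : Monotone f := monotone_of_deriv_nonneg (fun b => (hf b).differentiableAt)
    fun b => by rw [hf']; positivity
  have hf0 : ∀ a ≤ ε / 2, f a = 0 := fun a ha => by
    have : ∫ x in (ε / 2)..a, h x ^ 2 = 0 := by
      rw [intervalIntegral.integral_congr (g := fun _ => (0 : ℝ)), intervalIntegral.integral_zero]
      intro x hx
      rw [Set.uIcc_of_ge ha] at hx
      have : h x = 0 := hzero x (by rw [abs_of_nonpos] <;> linarith [hx.2])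
      simp [this]
    simp [f, this]
  have hf1 : ∀ a, ε ≤ a → f a = 1 := fun a ha => by
    have h0 : ∫ x in ε..a, h x ^ 2 = 0 := by
      rw [intervalIntegral.integral_congr (g := fun _ => (0 : ℝ)), intervalIntegral.integral_zero]
      intro x hx
      rw [Set.uIcc_of_le ha] at hx
      have : h x = 0 := hzero x (by rw [abs_of_nonneg] <;> linarith [hx.1])
      simp [this]
    have : ∫ x in (ε / 2)..a, h x ^ 2 = I := by
      rw [← intervalIntegral.integral_add_adjacent_intervals (hint (ε / 2) ε) (hint ε a), h0,
        add_zero]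
    simp [f, this, hIpos.ne']
  refine ⟨f, ⟨?_, fun a => ?_, hf0, hf1, fun a => ?_, ?_, ?_, ?_⟩, 1 / I, by positivity, ?_⟩
  · rw [contDiff_infty_iff_deriv, hf']
    exact ⟨fun b => (hf b).differentiableAt, (h.contDiff.pow 2).div_const I⟩
  · rcases le_total a (ε / 2) with ha | ha
    · exact (hf0 a ha).ge
    · exact (hf0 _ le_rfl).ge.trans (hmono ha)
  · rw [hf']
    positivity
  · rw [hsqrt]
    exact h.contDiff.div_const _
  · rw [hsqrt]
    simp only [div_eq_mul_inv]
    exact h.hasCompactSupport.mul_right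
  · have hsub : Function.support (deriv f) ⊆ Metric.closedBall (3 * ε / 4) ρ' := by
      intro a ha
      rw [Metric.mem_closedBall, Real.dist_eq]
      by_contra hlt
      exact ha (by simp [hf', hzero a (not_le.mp hlt).le])
    refine (closure_minimal hsub Metric.isClosed_closedBall).trans ?_
    intro a ha
    rw [Metric.mem_closedBall, Real.dist_eq, abs_le] at ha
    exact ⟨by linarith [ha.1], by linarith [ha.2]⟩
  · intro a ha
    have : h a = 1 := h.one_of_mem_closedBall ha
    simp [hf', this]

/-- First order expansion of a cutoff function, with a second order error that is controlled by the
derivative of a second cutoff function. -/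
theorem IsCutoff.exists_abs_sub_le {ε : ℝ} (hε : 0 < ε) {χ : ℝ → ℝ} (hχ : IsCutoff ε χ) :
    ∃ χ₂ : ℝ → ℝ, IsCutoff ε χ₂ ∧ ∃ M : ℝ, 0 ≤ M ∧ ∃ δ : ℝ, 0 < δ ∧ ∀ a b : ℝ, |b - a| < δ →
      |χ b - χ a| ≤ deriv χ a * |b - a| + M * deriv χ₂ a * |b - a| ^ 2 := by
  have hd : Differentiable ℝ χ := hχ.smooth.differentiable (by simp)
  have hd' : ContDiff ℝ ∞ (deriv χ) := (contDiff_infty_iff_deriv.mp hχ.smooth).2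
  have hball : Metric.ball (3 * ε / 4) (ε / 4) = Set.Ioo (ε / 2) ε := by
    rw [Real.ball_eq_Ioo]
    congr 1 <;> ring
  have hsupp := hχ.tsupport_deriv
  rw [← hball] at hsupp
  -- The support of `χ'` leaves room in the transition interval for a larger ball of radius `ρ`, on
  -- which `χ₂'` is at least `c`.
  obtain ⟨ρ₀, hρ₀, hsub⟩ := exists_pos_lt_subset_ball (by positivity) (isClosed_tsupport _) hsupp
  obtain ⟨ρ, hρ₀ρ, hρ⟩ := exists_between hρ₀.2
  obtain ⟨χ₂, hχ₂, c, hc, hcle⟩ := exists_isCutoff_deriv_ge (hρ₀.1.trans hρ₀ρ) hρ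
  have hcompact : HasCompactSupport (deriv χ) :=
    (isCompact_closedBall (3 * ε / 4) ρ₀).of_isClosed_subset (isClosed_tsupport _)
      (hsub.trans Metric.ball_subset_closedBall)
  obtain ⟨M, hM⟩ := hd'.lipschitzWith_of_hasCompactSupport hcompact (by simp)
  -- The Lipschitz constant of `χ'` is absorbed by `χ₂' ≥ c`; `δ` is the gap between the two radii.
  refine ⟨χ₂, hχ₂, M / c, by positivity, ρ - ρ₀, by linarith, fun a b hab => ?_⟩
  by_cases ha : a ∈ Metric.closedBall (3 * ε / 4) ρ
  · have key : ‖(χ b - deriv χ a * b) - (χ a - deriv χ a * a)‖ ≤ (M * |b - a|) * ‖b - a‖ := by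
      refine (convex_uIcc a b).norm_image_sub_le_of_norm_hasDerivWithin_le
        (f := fun x => χ x - deriv χ a * x) (f' := fun x => deriv χ x - deriv χ a)
        (fun x _ => ?_) (fun x hx => ?_) Set.left_mem_uIcc Set.right_mem_uIcc
      · have h0 := (hd x).hasDerivAt.sub ((hasDerivAt_id x).const_mul (deriv χ a))
        rw [mul_one] at h0
        exact h0.hasDerivWithinAt
      · have h1 := hM.dist_le_mul x a
        rw [Real.dist_eq, Real.dist_eq] at h1
        exact h1.trans (mul_le_mul_of_nonneg_left (Set.abs_sub_left_of_mem_uIcc hx) M.2)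
    rw [Real.norm_eq_abs, Real.norm_eq_abs] at key
    have h2 : |χ b - χ a| ≤ |deriv χ a * (b - a)| + M * |b - a| * |b - a| := by
      calc |χ b - χ a|
          = |deriv χ a * (b - a) + ((χ b - deriv χ a * b) - (χ a - deriv χ a * a))| := by
            congr 1; ring
        _ ≤ _ := (abs_add_le _ _).trans (by gcongr)
    rw [abs_mul, abs_of_nonneg (hχ.deriv_nonneg a)] at h2
    refine h2.trans ?_
    have h3 : (M : ℝ) ≤ M / c * deriv χ₂ a := by
      rw [div_mul_eq_mul_div, le_div_iff₀ hc]
      exact mul_le_mul_of_nonneg_left (hcle a ha) M.2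
    have h4 := mul_le_mul_of_nonneg_right h3 (sq_nonneg |b - a|)
    nlinarith
  -- If `a` is outside the larger ball, the segment to `b` misses the support of `χ'`, so `χ` is
  -- constant on it.
  · have hconst : ‖χ b - χ a‖ ≤ 0 * ‖b - a‖ := by
      refine (convex_uIcc a b).norm_image_sub_le_of_norm_deriv_le
        (fun x _ => hd x) (fun x hx => ?_) Set.left_mem_uIcc Set.right_mem_uIcc
      have hx' := Set.abs_sub_left_of_mem_uIcc hx
      have : x ∉ tsupport (deriv χ) := fun hmem => by
        have h1 := hsub hmem
        rw [Metric.mem_ball, Real.dist_eq] at h1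
        rw [Metric.mem_closedBall, Real.dist_eq, not_le] at ha
        have h2 := abs_sub_le a x (3 * ε / 4)
        rw [abs_sub_comm a x] at h2
        linarith
      simp [image_eq_zero_of_notMem_tsupport this]
    rw [zero_mul, Real.norm_eq_abs] at hconst
    refine hconst.trans ?_
    have h1 := hχ.deriv_nonneg a
    have h2 := hχ₂.deriv_nonneg a
    positivity

theorem IsCutoff.le_one {ε : ℝ} {χ : ℝ → ℝ} (hχ : IsCutoff ε χ) (a : ℝ) : χ a ≤ 1 := by
  have hmono : Monotone χ :=
    monotone_of_deriv_nonneg (hχ.smooth.differentiable (by simp)) hχ.deriv_nonneg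
  exact (hmono (le_max_left a ε)).trans (hχ.eq_one _ (le_max_right a ε)).le

/-! ### Geometry of the torus and lattice sums. -/

theorem siteNorm_nonneg {d L : ℕ} (x : Torus d L) : 0 ≤ siteNorm x := Real.sqrt_nonneg _

theorem siteNorm_neg {d L : ℕ} [NeZero L] (x : Torus d L) : siteNorm (-x) = siteNorm x := by
  unfold siteNorm
  congr 1
  refine Finset.sum_congr rfl fun i _ => ?_
  rw [sq_eq_sq_iff_abs_eq_abs]
  have := ZMod.natAbs_valMinAbs_neg (x i)
  rw [Pi.neg_apply, ← Int.cast_abs, ← Int.cast_abs, Int.abs_eq_natAbs, Int.abs_eq_natAbs, this]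

theorem siteNorm_sub_comm {d L : ℕ} [NeZero L] (x y : Torus d L) :
    siteNorm (x - y) = siteNorm (y - x) := by
  rw [← siteNorm_neg, neg_sub]

theorem siteNorm_add_le {d L : ℕ} [NeZero L] (x y : Torus d L) :
    siteNorm (x + y) ≤ siteNorm x + siteNorm y := by
  let e : Torus d L → EuclideanSpace ℝ (Fin d) :=
    fun x => WithLp.toLp 2 fun i => ((x i).valMinAbs : ℝ)
  have he : ∀ x, siteNorm x = ‖e x‖ := fun x => by
    simp [siteNorm, EuclideanSpace.norm_eq, e]
  rw [he x, he y]
  refine le_trans ?_ (norm_add_le _ _)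
  rw [siteNorm, EuclideanSpace.norm_eq]
  refine Real.sqrt_le_sqrt (Finset.sum_le_sum fun i _ => ?_)
  rw [Real.norm_eq_abs, sq_abs, sq_le_sq]
  have := ZMod.natAbs_valMinAbs_add_le (x i) (y i)
  simp only [e, Pi.add_apply, PiLp.add_apply]
  rw [← Int.cast_add, ← Int.cast_abs, ← Int.cast_abs, Int.abs_eq_natAbs, Int.abs_eq_natAbs]
  exact_mod_cast this

theorem abs_siteNorm_sub_le {d L : ℕ} [NeZero L] (x y : Torus d L) :
    |siteNorm x - siteNorm y| ≤ siteNorm (x - y) := by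
  rw [abs_le]
  have h1 := siteNorm_add_le (x - y) y
  have h2 := siteNorm_add_le (y - x) x
  rw [sub_add_cancel] at h1 h2
  rw [siteNorm_sub_comm y x] at h2
  constructor <;> linarith

/-- The number of sites in a ball. -/
theorem card_siteNorm_lt {d L : ℕ} [NeZero L] {S : ℝ} (hS : 0 < S) :
    (((Finset.univ.filter fun x : Torus d L => 1 + siteNorm x < S).card : ℕ) : ℝ)
      ≤ (2 * S) ^ d := by
  rcases lt_or_ge S 1 with h1 | h1
  · rw [Finset.filter_false_of_mem fun x _ => by linarith [siteNorm_nonneg x]]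
    simp only [Finset.card_empty, Nat.cast_zero]
    positivity
  -- A ball sits in a cube of integer points, since the least absolute representatives determine a
  -- site.
  have hcard : (Finset.univ.filter fun x : Torus d L => 1 + siteNorm x < S).card ≤
      (Fintype.piFinset fun _ : Fin d => Finset.Icc (-⌊S - 1⌋) ⌊S - 1⌋).card := by
    refine Finset.card_le_card_of_injOn (fun x i => (x i).valMinAbs) (fun x hx => ?_) ?_
    · have hx' : 1 + siteNorm x < S := by simpa using hx
      refine Finset.mem_coe.mpr (Fintype.mem_piFinset.mpr fun i => Finset.mem_Icc.mpr ?_)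
      have h2 : |((x i).valMinAbs : ℝ)| ≤ S - 1 := by
        rw [← Real.sqrt_sq_eq_abs]
        have : Real.sqrt (((x i).valMinAbs : ℝ) ^ 2) ≤ siteNorm x :=
          Real.sqrt_le_sqrt (Finset.single_le_sum
            (f := fun i => ((x i).valMinAbs : ℝ) ^ 2) (fun j _ => sq_nonneg _)
            (Finset.mem_univ i))
        linarith
      have h3 : |(x i).valMinAbs| ≤ ⌊S - 1⌋ := Int.le_floor.mpr (by exact_mod_cast h2)
      exact abs_le.mp h3
    · intro x _ y _ hxy
      funext i
      exact ZMod.injective_valMinAbs (congrFun hxy i)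
  refine (Nat.cast_le.mpr hcard).trans ?_
  rw [Fintype.card_piFinset, Finset.prod_const, Finset.card_univ, Fintype.card_fin, Nat.cast_pow]
  refine pow_le_pow_left₀ (by positivity) ?_ d
  have h4 : 0 ≤ ⌊S - 1⌋ := Int.floor_nonneg.mpr (by linarith)
  have h5 : ((⌊S - 1⌋ : ℤ) : ℝ) ≤ S - 1 := Int.floor_le _
  have h6 : (((Finset.Icc (-⌊S - 1⌋) ⌊S - 1⌋).card : ℕ) : ℝ) = 2 * (⌊S - 1⌋ : ℝ) + 1 := by
    rw [Int.card_Icc, ← Int.cast_natCast, Int.toNat_of_nonneg (by omega)]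
    push_cast
    ring
  rw [h6]
  linarith

/-- Tails of sums of powers over the torus, uniformly in its side length. -/
theorem exists_sum_rpow_tail_le (d : ℕ) {γ : ℝ} (hγ : (d : ℝ) < γ) :
    ∃ C : ℝ, 0 ≤ C ∧ ∀ (L : ℕ) [NeZero L] (T : ℝ), 0 < T →
      ∑ x ∈ Finset.univ.filter (fun x : Torus d L => T ≤ 1 + siteNorm x),
        (1 + siteNorm x) ^ (-γ) ≤ C * T ^ ((d : ℝ) - γ) := by
  -- Dyadic shells `T * 2 ^ k ≤ 1 + |x| < T * 2 ^ (k + 1)`; `q` is the ratio of successive shell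
  -- bounds, and summing over all `k` makes the constant independent of `L`.
  set q : ℝ := 2 ^ ((d : ℝ) - γ) with hq
  have hq0 : 0 < q := by positivity
  have hq1 : q < 1 := Real.rpow_lt_one_of_one_lt_of_neg (by norm_num) (by linarith)
  have hsum : Summable fun j : ℕ => q ^ j := summable_geometric_of_lt_one hq0.le hq1
  refine ⟨4 ^ d * ∑' j : ℕ, q ^ j, by positivity, fun L _ T hT => ?_⟩
  set s := Finset.univ.filter (fun x : Torus d L => T ≤ 1 + siteNorm x) with hs
  have hj : ∀ x : Torus d L, ∃ j : ℕ, x ∈ s →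
      T * 2 ^ j ≤ 1 + siteNorm x ∧ 1 + siteNorm x < T * 2 ^ (j + 1) := fun x => by
    by_cases hx : x ∈ s
    · have hx' : T ≤ 1 + siteNorm x := by simpa [hs] using hx
      obtain ⟨j, h1, h2⟩ := exists_nat_pow_near (x := (1 + siteNorm x) / T) (y := 2)
        (by rwa [le_div_iff₀ hT, one_mul]) (by norm_num)
      rw [le_div_iff₀ hT] at h1
      rw [div_lt_iff₀ hT] at h2
      exact ⟨j, fun _ => ⟨by linarith, by linarith⟩⟩
    · exact ⟨0, fun h => absurd h hx⟩
  choose j hj using hj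
  have hfib : ∀ k : ℕ, ∑ x ∈ s.filter (fun x => j x = k), (1 + siteNorm x) ^ (-γ) ≤
      4 ^ d * T ^ ((d : ℝ) - γ) * q ^ k := fun k => by
    have hpos : 0 < T * 2 ^ k := by positivity
    have hγ0 : 0 ≤ γ := (Nat.cast_nonneg d).trans hγ.le
    have hterm : ∀ x ∈ s.filter (fun x => j x = k),
        (1 + siteNorm x) ^ (-γ) ≤ (T * 2 ^ k) ^ (-γ) := fun x hx => by
      rw [Finset.mem_filter] at hx
      have := (hj x hx.1).1
      rw [hx.2] at this
      exact Real.rpow_le_rpow_of_nonpos hpos this (by linarith)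
    have hcard : (((s.filter fun x => j x = k).card : ℕ) : ℝ) ≤ (2 * (T * 2 ^ (k + 1))) ^ d := by
      refine le_trans (Nat.cast_le.mpr (Finset.card_le_card fun x hx => ?_))
        (card_siteNorm_lt (d := d) (L := L) (S := T * 2 ^ (k + 1)) (by positivity))
      rw [Finset.mem_filter] at hx
      have := (hj x hx.1).2
      rw [hx.2] at this
      simpa using this
    refine (Finset.sum_le_card_nsmul _ _ _ hterm).trans ?_
    rw [nsmul_eq_mul]
    refine (mul_le_mul_of_nonneg_right hcard (by positivity)).trans (le_of_eq ?_)
    have e1 : 2 * (T * 2 ^ (k + 1)) = 4 * (T * 2 ^ k) := by ring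
    rw [e1, mul_pow, mul_assoc, mul_assoc, ← Real.rpow_natCast (T * 2 ^ k) d, ← Real.rpow_add hpos,
      ← sub_eq_add_neg, Real.mul_rpow hT.le (by positivity), hq, ← Real.rpow_natCast 2 k,
      ← Real.rpow_natCast (2 ^ _) k, ← Real.rpow_mul (by norm_num), ← Real.rpow_mul (by norm_num),
      mul_comm (k : ℝ)]
  calc ∑ x ∈ s, (1 + siteNorm x) ^ (-γ)
      = ∑ k ∈ s.image j, ∑ x ∈ s.filter (fun x => j x = k), (1 + siteNorm x) ^ (-γ) :=
        (Finset.sum_fiberwise_of_maps_to (fun x hx => Finset.mem_image_of_mem j hx) _).symm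
    _ ≤ ∑ k ∈ s.image j, 4 ^ d * T ^ ((d : ℝ) - γ) * q ^ k := Finset.sum_le_sum fun k _ => hfib k
    _ = 4 ^ d * T ^ ((d : ℝ) - γ) * ∑ k ∈ s.image j, q ^ k := by rw [Finset.mul_sum]
    _ ≤ 4 ^ d * T ^ ((d : ℝ) - γ) * ∑' k : ℕ, q ^ k := by
        gcongr
        exact hsum.sum_le_tsum _ fun k _ => by positivity
    _ = _ := by ring

/-! ### Action of the operators on coefficient functions. -/

theorem creation_mul_annihilation_apply {d L : ℕ} (x y : Torus d L) (ψ : Config d L → ℂ)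
    (η : Config d L) :
    (creation x * annihilation y) ψ η = (Real.sqrt (η x) : ℂ) *
      ((Real.sqrt ((η - Pi.single x 1 : Config d L) y + 1) : ℂ) *
        ψ (η - Pi.single x 1 + Pi.single y 1)) := rfl

theorem number_apply {d L : ℕ} (x : Torus d L) (ψ : Config d L → ℂ) (η : Config d L) :
    number x ψ η = (η x : ℂ) * ψ η := by
  rw [number, creation_mul_annihilation_apply]
  rcases Nat.eq_zero_or_pos (η x) with h | h
  · simp [h]
  · have h1 : η - Pi.single x 1 + Pi.single x 1 = η := by
      refine tsub_add_cancel_of_le fun y => ?_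
      rcases eq_or_ne y x with rfl | hy
      · simpa using Nat.one_le_iff_ne_zero.mpr h.ne'
      · simp [hy]
    have h2 : (((η - Pi.single x 1 : Config d L) x : ℕ) : ℝ) + 1 = η x := by
      simp only [Pi.sub_apply, Pi.single_eq_same]
      rw [Nat.cast_sub h]
      simp
    rw [h1, h2, ← mul_assoc, ← Complex.ofReal_mul, Real.mul_self_sqrt (Nat.cast_nonneg _),
      Complex.ofReal_natCast]

theorem totalNumber_apply {d L : ℕ} [NeZero L] (ψ : Config d L → ℂ) (η : Config d L) :
    totalNumber d L ψ η = ((∑ x, η x : ℕ) : ℂ) * ψ η := by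
  simp [totalNumber, LinearMap.sum_apply, Finset.sum_apply, number_apply, Finset.sum_mul]

/-- The value of the weighted correlation observable on a configuration. -/
noncomputable def correlationValue {d L : ℕ} [NeZero L] (g : Torus d L → ℝ) (η : Config d L) : ℝ :=
  η 0 * ∑ z, g z * η z

theorem correlation_apply {d L : ℕ} [NeZero L] (g : Torus d L → ℝ) (ψ : Config d L → ℂ)
    (η : Config d L) : correlation g ψ η = (correlationValue g η : ℂ) * ψ η := by
  simp only [correlation, LinearMap.sum_apply, Finset.sum_apply, LinearMap.smul_apply,
    Pi.smul_apply, Module.End.mul_apply, number_apply, smul_eq_mul, correlationValue]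
  push_cast
  rw [Finset.mul_sum, Finset.sum_mul]
  exact Finset.sum_congr rfl fun z _ => by ring

theorem hamiltonian_apply {d L : ℕ} [NeZero L] (J : Matrix (Torus d L) (Torus d L) ℝ)
    (Φ : Config d L → ℝ) (ψ : Config d L → ℂ) (η : Config d L) :
    hamiltonian J Φ ψ η = ∑ x, ∑ y, (J x y : ℂ) * (creation x * annihilation y) ψ η +
      (Φ η : ℂ) * ψ η := by
  simp [hamiltonian, LinearMap.sum_apply, Finset.sum_apply, potential]

/-- The potential drops out because it is diagonal, like the observable; only hops that change the
value of the observable survive. -/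
theorem lie_hamiltonian_correlation_apply {d L : ℕ} [NeZero L]
    (J : Matrix (Torus d L) (Torus d L) ℝ) (Φ : Config d L → ℝ) (g : Torus d L → ℝ)
    (ψ : Config d L → ℂ) (η : Config d L) :
    ⁅Complex.I • hamiltonian J Φ, correlation g⁆ ψ η = Complex.I * ∑ x, ∑ y, (J x y : ℂ) *
      ((Real.sqrt (η x) : ℂ) * ((Real.sqrt ((η - Pi.single x 1 : Config d L) y + 1) : ℂ) *
        ((correlationValue g (η - Pi.single x 1 + Pi.single y 1) - correlationValue g η : ℝ) *
          ψ (η - Pi.single x 1 + Pi.single y 1)))) := by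
  simp only [Ring.lie_def, LinearMap.sub_apply, Pi.sub_apply, Module.End.mul_apply,
    LinearMap.smul_apply, Pi.smul_apply, smul_eq_mul]
  rw [correlation_apply, Pi.smul_apply, smul_eq_mul, hamiltonian_apply, hamiltonian_apply,
    correlation_apply]
  simp only [creation_mul_annihilation_apply, correlation_apply]
  rw [mul_left_comm _ Complex.I, ← mul_sub, mul_add, add_sub_add_comm]
  congr 1
  rw [mul_left_comm ((correlationValue g η : ℝ) : ℂ) (Φ η : ℂ), sub_self, add_zero,
    Finset.mul_sum, ← Finset.sum_sub_distrib]
  refine Finset.sum_congr rfl fun x _ => ?_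
  rw [Finset.mul_sum, ← Finset.sum_sub_distrib]
  refine Finset.sum_congr rfl fun y _ => ?_
  rw [Complex.ofReal_sub]
  simp only [Pi.sub_apply]
  ring

/-! ### Moments of the hopping terms. -/

section Hopping

variable {d L : ℕ} {ψ : Config d L → ℂ}

/-- The contribution to `⟨ψ, b_x† b_y ψ⟩` of a configuration `ζ` of the other bosons. -/
noncomputable def hopTerm (ψ : Config d L → ℂ) (x y : Torus d L) (ζ : Config d L) : ℂ :=
  conj (ψ (ζ + Pi.single x 1)) *
    ((Real.sqrt (ζ x + 1) * Real.sqrt (ζ y + 1) : ℝ) * ψ (ζ + Pi.single y 1))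

theorem add_single_injective (x : Torus d L) :
    Function.Injective fun ζ : Config d L => ζ + Pi.single x 1 :=
  fun _ _ h => add_right_cancel h

theorem mem_range_add_single {x : Torus d L} {η : Config d L} (h : η x ≠ 0) :
    η ∈ Set.range fun ζ : Config d L => ζ + Pi.single x 1 := by
  refine ⟨η - Pi.single x 1, tsub_add_cancel_of_le fun y => ?_⟩
  rcases eq_or_ne y x with rfl | hy
  · simpa using Nat.one_le_iff_ne_zero.mpr h
  · simp [hy]

/-- Rows with `η x = 0` vanish through the square root; all others are `ζ + δ_x`, where `ζ` is the
configuration without the hopping boson. This removes the truncated subtraction. -/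
theorem hasSum_hop (x y : Torus d L) {c : Config d L → ℂ} {S : ℂ}
    (h : HasSum (fun ζ => hopTerm ψ x y ζ * c (ζ + Pi.single x 1)) S) :
    HasSum (fun η => conj (ψ η) * ((Real.sqrt (η x) : ℂ) *
      ((Real.sqrt ((η - Pi.single x 1 : Config d L) y + 1) : ℂ) *
        (c η * ψ (η - Pi.single x 1 + Pi.single y 1))))) S := by
  refine ((add_single_injective x).hasSum_iff fun η hη => ?_).mp ?_
  · by_cases h0 : η x = 0
    · simp [h0]
    · exact absurd (mem_range_add_single h0) hη
  · convert h using 1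
    funext ζ
    simp only [Function.comp_apply, add_tsub_cancel_right, hopTerm, Pi.add_apply,
      Pi.single_eq_same, Nat.cast_add, Nat.cast_one, Complex.ofReal_mul]
    ring

/-- Finiteness of the second moment of the total number of bosons. -/
def FiniteSecondMoment [NeZero L] (ψ : Config d L → ℂ) : Prop :=
  Summable fun η : Config d L => ((∑ x, η x : ℕ) : ℝ) ^ 2 * ‖ψ η‖ ^ 2

theorem FiniteSecondMoment.summable_of_le [NeZero L] (hψ : FiniteSecondMoment ψ) {f : Config d L → ℝ} (C : ℝ)
    (hf : ∀ η, |f η| ≤ C * ((∑ x, η x : ℕ) : ℝ) ^ 2) :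
    Summable fun η => f η * ‖ψ η‖ ^ 2 := by
  refine Summable.of_norm_bounded (Summable.mul_left C hψ) fun η => ?_
  rw [Real.norm_eq_abs, abs_mul, abs_of_nonneg (sq_nonneg ‖ψ η‖), ← mul_assoc]
  exact mul_le_mul_of_nonneg_right (hf η) (sq_nonneg _)

theorem le_totalCount [NeZero L] (η : Config d L) (x : Torus d L) : (η x : ℝ) ≤ ((∑ x, η x : ℕ) : ℝ) :=
  Nat.cast_le.mpr (Finset.single_le_sum (fun _ _ => Nat.zero_le _) (Finset.mem_univ x))

theorem totalCount_le_sq [NeZero L] (η : Config d L) :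
    ((∑ x, η x : ℕ) : ℝ) ≤ ((∑ x, η x : ℕ) : ℝ) ^ 2 := by
  exact_mod_cast Nat.le_self_pow two_ne_zero _

theorem FiniteSecondMoment.summable_mul [NeZero L] (hψ : FiniteSecondMoment ψ) (x y : Torus d L) :
    Summable fun η => (η x * η y : ℝ) * ‖ψ η‖ ^ 2 := by
  refine hψ.summable_of_le 1 fun η => ?_
  rw [abs_of_nonneg (by positivity), one_mul, sq]
  exact mul_le_mul (le_totalCount η x) (le_totalCount η y) (by positivity) (by positivity)

theorem FiniteSecondMoment.summable_single [NeZero L] (hψ : FiniteSecondMoment ψ) (x : Torus d L) :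
    Summable fun η => (η x : ℝ) * ‖ψ η‖ ^ 2 := by
  refine hψ.summable_of_le 1 fun η => ?_
  rw [abs_of_nonneg (by positivity), one_mul]
  exact (le_totalCount η x).trans (totalCount_le_sq η)

/-- The correlation `⟨n_0 n_x⟩`. -/
noncomputable def pairMoment (ψ : Config d L → ℂ) (x : Torus d L) : ℝ :=
  ∑' η : Config d L, (η 0 * η x : ℝ) * ‖ψ η‖ ^ 2

theorem pairMoment_nonneg (ψ : Config d L → ℂ) (x : Torus d L) : 0 ≤ pairMoment ψ x :=
  tsum_nonneg fun _ => by positivity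

/-- The symmetrized weight of `n_z` in a hop between `x` and `y`. -/
def hopWeight (x y z : Torus d L) (ζ : Config d L) : ℝ :=
  ((ζ + Pi.single x 1 : Config d L) z : ℝ) + ((ζ + Pi.single y 1 : Config d L) z : ℝ)

theorem hopWeight_nonneg (x y z : Torus d L) (ζ : Config d L) : 0 ≤ hopWeight x y z ζ := by
  unfold hopWeight
  positivity

/-- The inequality `2ab ≤ a² + b²`, with each square root paired with the amplitude at the same
site. -/
theorem norm_hopTerm_mul_le (x y z : Torus d L) (ζ : Config d L) :
    ‖hopTerm ψ x y ζ * (hopWeight x y z ζ : ℂ)‖ ≤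
      hopWeight x y z ζ / 2 * ((ζ x + 1 : ℝ) * ‖ψ (ζ + Pi.single x 1)‖ ^ 2) +
      hopWeight x y z ζ / 2 * ((ζ y + 1 : ℝ) * ‖ψ (ζ + Pi.single y 1)‖ ^ 2) := by
  have hw := hopWeight_nonneg x y z ζ
  rw [norm_mul, Complex.norm_real, Real.norm_eq_abs, abs_of_nonneg hw, hopTerm, norm_mul, norm_mul,
    Complex.norm_real, RCLike.norm_conj, Real.norm_eq_abs, abs_of_nonneg (by positivity)]
  have h1 := two_mul_le_add_sq (Real.sqrt (ζ x + 1) * ‖ψ (ζ + Pi.single x 1)‖)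
    (Real.sqrt (ζ y + 1) * ‖ψ (ζ + Pi.single y 1)‖)
  rw [mul_pow, mul_pow, Real.sq_sqrt (by positivity), Real.sq_sqrt (by positivity)] at h1
  have h2 := mul_le_mul_of_nonneg_right h1 hw
  linarith

/-- The first summand in the bound on a weighted hop, expressed on the configuration with the
boson at `x`. -/
theorem hopWeight_mul_left (x y : Torus d L) (ζ : Config d L) :
    hopWeight x y 0 ζ / 2 * ((ζ x + 1 : ℝ) * ‖ψ (ζ + Pi.single x 1)‖ ^ 2) =
      ((fun η : Config d L => (η 0 * η x : ℝ) * ‖ψ η‖ ^ 2 +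
        (((Pi.single y 1 : Config d L) 0 : ℝ) - ((Pi.single x 1 : Config d L) 0 : ℝ)) / 2 *
          ((η x : ℝ) * ‖ψ η‖ ^ 2)) ∘ fun ζ => ζ + Pi.single x 1) ζ := by
  simp only [hopWeight, Function.comp_apply, Pi.add_apply, Pi.single_eq_same, Nat.cast_add,
    Nat.cast_one]
  ring

theorem FiniteSecondMoment.hasSum_hopWeight_left [NeZero L] (hψ : FiniteSecondMoment ψ) (x y : Torus d L) :
    HasSum (fun ζ => hopWeight x y 0 ζ / 2 * ((ζ x + 1 : ℝ) * ‖ψ (ζ + Pi.single x 1)‖ ^ 2))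
      (pairMoment ψ x +
        (((Pi.single y 1 : Config d L) 0 : ℝ) - ((Pi.single x 1 : Config d L) 0 : ℝ)) / 2 *
          ∑' η : Config d L, (η x : ℝ) * ‖ψ η‖ ^ 2) := by
  have h := (hψ.summable_mul 0 x).hasSum.add ((hψ.summable_single x).hasSum.mul_left
    ((((Pi.single y 1 : Config d L) 0 : ℝ) - ((Pi.single x 1 : Config d L) 0 : ℝ)) / 2))
  rw [funext (hopWeight_mul_left x y)]
  refine ((add_single_injective x).hasSum_iff fun η hη => ?_).mpr h
  by_cases h0 : η x = 0
  · simp [h0]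
  · exact absurd (mem_range_add_single h0) hη

theorem hopWeight_mul_swap (x y z : Torus d L) (ζ : Config d L) :
    hopWeight x y z ζ / 2 * ((ζ y + 1 : ℝ) * ‖ψ (ζ + Pi.single y 1)‖ ^ 2) =
      hopWeight y x z ζ / 2 * ((ζ y + 1 : ℝ) * ‖ψ (ζ + Pi.single y 1)‖ ^ 2) := by
  rw [hopWeight, add_comm, ← hopWeight]

theorem totalCount_add_single [NeZero L] (x : Torus d L) (ζ : Config d L) :
    ∑ z, (ζ + Pi.single x 1 : Config d L) z = ∑ z, ζ z + 1 := by
  simp [Finset.sum_add_distrib]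

theorem FiniteSecondMoment.summable_hopWeight_left [NeZero L] (hψ : FiniteSecondMoment ψ)
    (x y z : Torus d L) :
    Summable fun ζ : Config d L =>
      hopWeight x y z ζ / 2 * ((ζ x + 1 : ℝ) * ‖ψ (ζ + Pi.single x 1)‖ ^ 2) := by
  refine Summable.of_nonneg_of_le (fun ζ => ?_) (fun ζ => ?_)
    (hψ.comp_injective (add_single_injective x))
  · have := hopWeight_nonneg x y z ζ
    positivity
  · have h1 := le_totalCount (ζ + Pi.single x 1) z
    have h2 := le_totalCount (ζ + Pi.single y 1) z
    have h3 := le_totalCount (ζ + Pi.single x 1) x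
    have h4 : hopWeight x y z ζ / 2 ≤ ((∑ z, (ζ + Pi.single x 1 : Config d L) z : ℕ) : ℝ) := by
      rw [totalCount_add_single] at h1 h2 ⊢
      rw [hopWeight]
      linarith
    have h5 : (ζ x + 1 : ℝ) ≤ ((∑ z, (ζ + Pi.single x 1 : Config d L) z : ℕ) : ℝ) := by
      simpa using h3
    rw [Function.comp_apply, ← mul_assoc]
    refine mul_le_mul_of_nonneg_right ?_ (sq_nonneg _)
    exact (mul_le_mul h4 h5 (by positivity) (by positivity)).trans (sq _).ge

theorem FiniteSecondMoment.summable_hopTerm [NeZero L] (hψ : FiniteSecondMoment ψ)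
    (x y z : Torus d L) :
    Summable fun ζ : Config d L => hopTerm ψ x y ζ * (hopWeight x y z ζ : ℂ) := by
  refine Summable.of_norm_bounded ((hψ.summable_hopWeight_left x y z).add
    (hψ.summable_hopWeight_left y x z)) fun ζ => ?_
  rw [← hopWeight_mul_swap x y z]
  exact norm_hopTerm_mul_le x y z ζ

/-- The symmetrized moment `⟨b_x† b_y n_z + n_z b_x† b_y⟩`. -/
noncomputable def hopMoment (ψ : Config d L → ℂ) (x y z : Torus d L) : ℂ :=
  ∑' ζ : Config d L, hopTerm ψ x y ζ * (hopWeight x y z ζ : ℂ)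

/-- The two halves carry opposite corrections, nonzero only if exactly one of `x`, `y` is the
origin. They are multiples of `⟨n_x⟩` and `⟨n_y⟩`, so equal occupations make them cancel. -/
theorem FiniteSecondMoment.norm_hopMoment_le [NeZero L] (hψ : FiniteSecondMoment ψ)
    (hocc : ∀ x y : Torus d L,
      ∑' η : Config d L, (η x : ℝ) * ‖ψ η‖ ^ 2 = ∑' η : Config d L, (η y : ℝ) * ‖ψ η‖ ^ 2)
    (x y : Torus d L) : ‖hopMoment ψ x y 0‖ ≤ pairMoment ψ x + pairMoment ψ y := by
  have h := (hψ.hasSum_hopWeight_left x y).add (hψ.hasSum_hopWeight_left y x)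
  rw [hocc y x] at h
  have e : pairMoment ψ x + pairMoment ψ y = _ := (by ring : _ = _).trans h.tsum_eq.symm
  rw [e]
  refine tsum_of_norm_bounded h.summable.hasSum fun ζ => ?_
  rw [← hopWeight_mul_swap x y 0]
  exact norm_hopTerm_mul_le x y 0 ζ

/-- The identity `ab - a'b' = ((b - b')(a + a') + (a - a')(b + b')) / 2`, with `a` the occupation of
the origin and `b` the weighted sum. Symmetrizing avoids ordering corrections. -/
theorem correlationValue_sub [NeZero L] (g : Torus d L → ℝ) (x y : Torus d L) (ζ : Config d L) :
    correlationValue g (ζ + Pi.single y 1) - correlationValue g (ζ + Pi.single x 1) =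
      1 / 2 * ((g y - g x) * hopWeight x y 0 ζ +
        (((Pi.single y 1 : Config d L) 0 : ℝ) - ((Pi.single x 1 : Config d L) 0 : ℝ)) *
          ∑ z, g z * hopWeight x y z ζ) := by
  have h : ∀ u : Torus d L, ∑ z, g z * ((ζ + Pi.single u 1 : Config d L) z : ℝ) =
      ∑ z, g z * ζ z + g u := fun u => by
    simp only [Pi.add_apply, Nat.cast_add, mul_add, Finset.sum_add_distrib]
    congr 1
    rw [Finset.sum_eq_single u]
    · simp
    · intro z _ hz
      simp [hz]
    · simp
  have h2 : ∑ z, g z * hopWeight x y z ζ = 2 * ∑ z, g z * (ζ z : ℝ) + g x + g y := by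
    simp only [hopWeight, mul_add, Finset.sum_add_distrib]
    rw [h x, h y]
    ring
  rw [correlationValue, correlationValue, h x, h y, h2, hopWeight]
  simp only [Pi.add_apply, Nat.cast_add]
  ring

theorem FiniteSecondMoment.hasSum_lie [NeZero L] (hψ : FiniteSecondMoment ψ)
    (J : Matrix (Torus d L) (Torus d L) ℝ) (Φ : Config d L → ℝ) (g : Torus d L → ℝ) :
    HasSum (fun η => conj (ψ η) * ⁅Complex.I • hamiltonian J Φ, correlation g⁆ ψ η)
      (Complex.I * ∑ x, ∑ y, (J x y : ℂ) * (1 / 2 * (((g y - g x : ℝ) : ℂ) * hopMoment ψ x y 0 +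
        ((((Pi.single y 1 : Config d L) 0 : ℝ) - ((Pi.single x 1 : Config d L) 0 : ℝ) : ℝ) : ℂ) *
          ∑ z, (g z : ℂ) * hopMoment ψ x y z))) := by
  have key : ∀ x y : Torus d L, HasSum (fun η => conj (ψ η) * ((Real.sqrt (η x) : ℂ) *
      ((Real.sqrt ((η - Pi.single x 1 : Config d L) y + 1) : ℂ) *
        ((correlationValue g (η - Pi.single x 1 + Pi.single y 1) - correlationValue g η : ℝ) *
          ψ (η - Pi.single x 1 + Pi.single y 1)))))
      (1 / 2 * (((g y - g x : ℝ) : ℂ) * hopMoment ψ x y 0 +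
        ((((Pi.single y 1 : Config d L) 0 : ℝ) - ((Pi.single x 1 : Config d L) 0 : ℝ) : ℝ) : ℂ) *
          ∑ z, (g z : ℂ) * hopMoment ψ x y z)) := fun x y => by
    refine hasSum_hop x y (c := fun η =>
      ((correlationValue g (η - Pi.single x 1 + Pi.single y 1) - correlationValue g η : ℝ) : ℂ)) ?_
    have hz : ∀ z, HasSum _ (hopMoment ψ x y z) := fun z => (hψ.summable_hopTerm x y z).hasSum
    have h := (((hz 0).mul_left ((g y - g x : ℝ) : ℂ)).add
      ((hasSum_sum (s := Finset.univ) fun z _ => (hz z).mul_left (g z : ℂ)).mul_left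
        ((((Pi.single y 1 : Config d L) 0 : ℝ) - ((Pi.single x 1 : Config d L) 0 : ℝ) : ℝ) :
          ℂ))).mul_left (1 / 2 : ℂ)
    refine Eq.mpr (congrArg (fun f => HasSum f _) (funext fun ζ => ?_)) h
    rw [add_tsub_cancel_right, correlationValue_sub]
    have e : ∑ z, (g z : ℂ) * (hopTerm ψ x y ζ * (hopWeight x y z ζ : ℂ)) =
        hopTerm ψ x y ζ * ((∑ z, g z * hopWeight x y z ζ : ℝ) : ℂ) := by
      rw [Complex.ofReal_sum, Finset.mul_sum]
      refine Finset.sum_congr rfl fun z _ => ?_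
      rw [Complex.ofReal_mul]
      ring
    rw [e, Complex.ofReal_mul, Complex.ofReal_add, Complex.ofReal_mul, Complex.ofReal_mul]
    norm_num
    ring
  have h := (hasSum_sum (s := Finset.univ) fun x _ => hasSum_sum (s := Finset.univ) fun y _ =>
    (key x y).mul_left (J x y : ℂ)).mul_left Complex.I
  refine Eq.mpr (congrArg (fun f => HasSum f _) (funext fun η => ?_)) h
  rw [lie_hamiltonian_correlation_apply, mul_left_comm, Finset.mul_sum]
  congr 1
  refine Finset.sum_congr rfl fun x _ => ?_
  rw [Finset.mul_sum]
  exact Finset.sum_congr rfl fun y _ => mul_left_comm _ _ _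

end Hopping

/-! ### Translations and time evolution on the sectors. -/

section Evolution

variable {d L : ℕ}

theorem creation_mul_annihilation_add_single (x y : Torus d L) (ψ : Config d L → ℂ)
    (ζ : Config d L) :
    (creation x * annihilation y) ψ (ζ + Pi.single x 1) = (Real.sqrt (ζ x + 1) : ℂ) *
      ((Real.sqrt (ζ y + 1) : ℂ) * ψ (ζ + Pi.single y 1)) := by
  rw [creation_mul_annihilation_apply, add_tsub_cancel_right]
  simp

theorem creation_mul_annihilation_of_eq_zero {x : Torus d L} (y : Torus d L) (ψ : Config d L → ℂ)
    {η : Config d L} (h : η x = 0) : (creation x * annihilation y) ψ η = 0 := by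
  rw [creation_mul_annihilation_apply, h]
  simp

/-- The adjoint of `b_x† b_y` is `b_y† b_x`: both sides are nonzero only for `η = ζ + δ_x`, `ξ = ζ +
δ_y` with a common `ζ`. -/
theorem creation_mul_annihilation_single_comm [NeZero L] (x y : Torus d L) (η ξ : Config d L) :
    (creation x * annihilation y) (Pi.single ξ 1) η =
      conj ((creation y * annihilation x) (Pi.single η 1) ξ) := by
  by_cases hη : η x = 0
  · rw [creation_mul_annihilation_of_eq_zero y _ hη]
    by_cases hξ : ξ y = 0
    · rw [creation_mul_annihilation_of_eq_zero x _ hξ, map_zero]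
    · obtain ⟨ζ, rfl⟩ := mem_range_add_single hξ
      have : ζ + Pi.single x 1 ≠ η := by
        rintro rfl
        simp at hη
      simp [creation_mul_annihilation_add_single, this]
  · obtain ⟨ζ, rfl⟩ := mem_range_add_single hη
    by_cases hξ : ξ y = 0
    · have : ζ + Pi.single y 1 ≠ ξ := by
        rintro rfl
        simp at hξ
      rw [creation_mul_annihilation_of_eq_zero x _ hξ]
      simp [creation_mul_annihilation_add_single, this]
    · obtain ⟨ζ', rfl⟩ := mem_range_add_single hξ
      simp only [creation_mul_annihilation_add_single]
      by_cases h : ζ = ζ'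
      · subst h
        simp [mul_comm]
      · simp [h, Ne.symm h]

theorem sectorMatrix_hamiltonian_isHermitian [NeZero L] {J : Matrix (Torus d L) (Torus d L) ℝ}
    (hJ : J.IsSymm) (Φ : Config d L → ℝ) (N : ℕ) :
    (sectorMatrix (hamiltonian J Φ) N).IsHermitian := by
  refine Matrix.IsHermitian.ext fun η ξ => ?_
  change conj (hamiltonian J Φ (Pi.single (η : Config d L) 1) ξ) =
    hamiltonian J Φ (Pi.single (ξ : Config d L) 1) η
  rw [hamiltonian_apply, hamiltonian_apply, map_add]
  congr 1
  · simp only [map_sum, map_mul, Complex.conj_ofReal]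
    rw [Finset.sum_comm]
    refine Finset.sum_congr rfl fun x _ => Finset.sum_congr rfl fun y _ => ?_
    rw [← creation_mul_annihilation_single_comm, hJ.apply]
  · by_cases h : (η : Config d L) = ξ
    · simp [h]
    · simp [h, Ne.symm h]

/-- The translation of configurations that underlies `translation z`. -/
def shift (z : Torus d L) : Config d L ≃ Config d L :=
  (Equiv.subRight z).symm.arrowCongr (Equiv.refl ℕ)

theorem shift_apply (z : Torus d L) (η : Config d L) (y : Torus d L) :
    shift z η y = η (y - z) := rfl

theorem translation_apply (z : Torus d L) (ψ : Config d L → ℂ) (η : Config d L) :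
    translation z ψ η = ψ (shift z η) := rfl

theorem shift_neg_shift (z : Torus d L) (η : Config d L) : shift (-z) (shift z η) = η := by
  funext y
  simp [shift_apply]

theorem shift_add_single (z x : Torus d L) (ζ : Config d L) :
    shift z (ζ + Pi.single (x - z) 1) = shift z ζ + Pi.single x 1 := by
  funext y
  simp only [shift_apply, Pi.add_apply, Pi.single_apply, sub_left_inj]

theorem shift_single (z x : Torus d L) :
    shift z (Pi.single (x - z) 1) = Pi.single x 1 := by
  funext y
  simp only [shift_apply, Pi.single_apply, sub_left_inj]

theorem totalCount_shift [NeZero L] (z : Torus d L) (η : Config d L) :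
    ∑ x, shift z η x = ∑ x, η x :=
  Equiv.sum_comp (Equiv.subRight z) η

theorem IsTranslationInvariantOp.apply_single [NeZero L] {O : Operator d L} (hO : IsTranslationInvariantOp O)
    (z : Torus d L) (η ξ : Config d L) :
    O (Pi.single (shift z ξ) 1) (shift z η) = O (Pi.single ξ 1) η := by
  have h := congrFun (LinearMap.congr_fun (hO z) (Pi.single (shift z ξ) 1)) (shift z η)
  rw [Module.End.mul_apply, Module.End.mul_apply, translation_apply, shift_neg_shift] at h
  have e : translation z (Pi.single (shift z ξ) 1) = Pi.single ξ 1 := by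
    funext ζ
    simp [translation_apply, Pi.single_apply]
  rw [← h, e]

theorem hamiltonian_single [NeZero L] (J : Matrix (Torus d L) (Torus d L) ℝ)
    (Φ : Config d L → ℝ) {x y : Torus d L} (hxy : x ≠ y) :
    hamiltonian J Φ (Pi.single (Pi.single y 1 : Config d L) 1) (Pi.single x 1) = (J x y : ℂ) := by
  have hne : ∀ {a b : Torus d L}, (Pi.single a 1 : Config d L) = Pi.single b 1 ↔ a = b :=
    fun {a b} => ⟨fun h => by
      by_contra hab
      have := congrFun h a
      simp [hab] at this, fun h => h ▸ rfl⟩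
  rw [hamiltonian_apply, Pi.single_eq_of_ne (by rwa [Ne, hne]), mul_zero, add_zero,
    Finset.sum_eq_single x, Finset.sum_eq_single y]
  · have := creation_mul_annihilation_add_single x y (Pi.single (Pi.single y 1 : Config d L) 1) 0
    rw [zero_add, zero_add] at this
    rw [this]
    simp
  · intro b _ hb
    have := creation_mul_annihilation_add_single x b (Pi.single (Pi.single y 1 : Config d L) 1) 0
    rw [zero_add, zero_add] at this
    rw [this, Pi.single_eq_of_ne (by rwa [Ne, hne])]
    simp
  · simp
  · intro a _ ha
    refine Finset.sum_eq_zero fun b _ => ?_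
    rw [creation_mul_annihilation_of_eq_zero b _ (by simp [ha]), mul_zero]
  · simp

/-- Invariance is tested on one-boson states. Diagonal entries are excluded because there `J x x`
appears only in combination with `Φ`. -/
theorem IsTranslationInvariantOp.hopping_sub [NeZero L] {J : Matrix (Torus d L) (Torus d L) ℝ}
    {Φ : Config d L → ℝ} (hO : IsTranslationInvariantOp (hamiltonian J Φ)) {x y : Torus d L}
    (hxy : x ≠ y) (z : Torus d L) : J (x - z) (y - z) = J x y := by
  have h := hO.apply_single z (Pi.single (x - z) 1) (Pi.single (y - z) 1)
  rw [shift_single, shift_single, hamiltonian_single J Φ hxy,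
    hamiltonian_single J Φ (fun h => hxy (sub_left_injective h))] at h
  exact_mod_cast h.symm

/-- The permutation of a sector by a translation. -/
def sectorShift [NeZero L] (z : Torus d L) (N : ℕ) : Equiv.Perm (Sector d L N) :=
  (shift z).subtypeEquiv fun η => by simp [totalCount_shift]

/-- Invariance says that the sector matrix commutes with a permutation matrix, hence so does its
exponential. -/
theorem IsTranslationInvariantOp.exp_sectorMatrix [NeZero L] {O : Operator d L}
    (hO : IsTranslationInvariantOp O) (c : ℂ) (z : Torus d L) (N : ℕ) (η ξ : Sector d L N) :
    NormedSpace.exp (c • sectorMatrix O N) (sectorShift z N η) (sectorShift z N ξ) =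
      NormedSpace.exp (c • sectorMatrix O N) η ξ := by
  set A := c • sectorMatrix O N with hA
  have hsub : ∀ η ξ, A (sectorShift z N η) (sectorShift z N ξ) = A η ξ := fun η ξ => by
    simp only [hA, Matrix.smul_apply, sectorMatrix]
    congr 1
    exact hO.apply_single z η ξ
  have hcomm : Commute ((sectorShift z N).toPEquiv.toMatrix : Matrix _ _ ℂ) A := by
    rw [Commute, SemiconjBy, PEquiv.toMatrix_toPEquiv_mul, PEquiv.mul_toMatrix_toPEquiv]
    ext i j
    rw [Matrix.submatrix_apply, Matrix.submatrix_apply]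
    have := hsub i ((sectorShift z N).symm j)
    rwa [Equiv.apply_symm_apply] at this
  have hexp : Commute ((sectorShift z N).toPEquiv.toMatrix : Matrix _ _ ℂ) (NormedSpace.exp A) :=
    by
      let _ : NormedRing (Matrix (Sector d L N) (Sector d L N) ℂ) := Matrix.linftyOpNormedRing
      let _ : NormedAlgebra ℂ (Matrix (Sector d L N) (Sector d L N) ℂ) :=
        Matrix.linftyOpNormedAlgebra
      exact hcomm.exp_right
  rw [Commute, SemiconjBy, PEquiv.toMatrix_toPEquiv_mul, PEquiv.mul_toMatrix_toPEquiv] at hexp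
  have := congrFun (congrFun hexp η) (sectorShift z N ξ)
  rwa [Matrix.submatrix_apply, Matrix.submatrix_apply, Equiv.symm_apply_apply] at this

theorem evolve_apply [NeZero L] (H : Operator d L) (t : ℝ) (ψ : Config d L → ℂ) (N : ℕ)
    (η : Sector d L N) :
    evolve H t ψ η = (NormedSpace.exp ((-(Complex.I * (t : ℂ))) • sectorMatrix H N)).mulVec
      (fun ξ => ψ (ξ : Config d L)) η := by
  obtain ⟨η, hη⟩ := η
  have hN : ∑ x, η x = N := by simpa using hη
  subst hN
  rfl

theorem IsTranslationInvariantOp.evolve_shift [NeZero L] {H : Operator d L}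
    (hH : IsTranslationInvariantOp H) (t : ℝ) {ψ : Config d L → ℂ} {z : Torus d L} {c : ℂ}
    (hψ : translation z ψ = c • ψ) (η : Config d L) :
    evolve H t ψ (shift z η) = c * evolve H t ψ η := by
  set N := ∑ x, η x with hN
  let η' : Sector d L N := ⟨η, by simp [hN]⟩
  have h1 := evolve_apply H t ψ N η'
  have h2 := evolve_apply H t ψ N (sectorShift z N η')
  change evolve H t ψ η = _ at h1
  change evolve H t ψ (shift z η) = _ at h2
  rw [h1, h2]
  simp only [Matrix.mulVec, dotProduct]
  rw [← Equiv.sum_comp (sectorShift z N), Finset.mul_sum]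
  refine Finset.sum_congr rfl fun ξ _ => ?_
  rw [hH.exp_sectorMatrix]
  have h3 := congrFun hψ (ξ : Config d L)
  rw [translation_apply, Pi.smul_apply, smul_eq_mul] at h3
  change _ * ψ (shift z ξ) = _
  rw [h3]
  ring

/-- The exponential of a skew-Hermitian matrix is unitary. -/
theorem sum_norm_sq_mulVec_exp {ι : Type*} [Fintype ι] [DecidableEq ι] {A : Matrix ι ι ℂ}
    (hA : A.IsHermitian) (t : ℝ) (u : ι → ℂ) :
    ∑ i, ‖(NormedSpace.exp ((-(Complex.I * (t : ℂ))) • A)).mulVec u i‖ ^ 2 = ∑ i, ‖u i‖ ^ 2 := by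
  set B := (-(Complex.I * (t : ℂ))) • A with hB
  have hBH : B.conjTranspose = -B := by
    rw [hB, Matrix.conjTranspose_smul, hA.eq, ← neg_smul]
    congr 1
    simp
  have hU : (NormedSpace.exp B).conjTranspose * NormedSpace.exp B = 1 := by
    rw [← Matrix.exp_conjTranspose, hBH, ← Matrix.exp_add_of_commute _ _ (Commute.neg_left
      (Commute.refl B)), neg_add_cancel, NormedSpace.exp_zero]
  have hdot : ∀ u : ι → ℂ, ((∑ i, ‖u i‖ ^ 2 : ℝ) : ℂ) = star u ⬝ᵥ u := fun u => by
    simp only [dotProduct, Complex.ofReal_sum, Pi.star_apply]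
    refine Finset.sum_congr rfl fun i _ => ?_
    rw [Complex.ofReal_pow, ← Complex.conj_mul']
    rfl
  rw [← Complex.ofReal_inj, hdot, hdot, Matrix.star_mulVec, Matrix.dotProduct_mulVec,
    Matrix.vecMul_vecMul, hU, Matrix.vecMul_one]

theorem sum_sector_norm_sq_evolve [NeZero L] {H : Operator d L}
    (hH : ∀ N, (sectorMatrix H N).IsHermitian) (t : ℝ) (ψ : Config d L → ℂ) (N : ℕ) :
    ∑ η ∈ Finset.piAntidiag (Finset.univ : Finset (Torus d L)) N, ‖evolve H t ψ η‖ ^ 2 =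
      ∑ η ∈ Finset.piAntidiag (Finset.univ : Finset (Torus d L)) N, ‖ψ η‖ ^ 2 := by
  have h := sum_norm_sq_mulVec_exp (hH N) t fun ξ => ψ (ξ : Config d L)
  have e : ∀ η : Sector d L N, (NormedSpace.exp ((-(Complex.I * (t : ℂ))) •
      sectorMatrix H N)).mulVec (fun ξ => ψ (ξ : Config d L)) η = evolve H t ψ η :=
    fun η => (evolve_apply H t ψ N η).symm
  simp only [e] at h
  rw [Finset.univ_eq_attach] at h
  rwa [Finset.sum_attach _ fun η => ‖evolve H t ψ η‖ ^ 2, Finset.sum_attach _ fun η => ‖ψ η‖ ^ 2] at h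

/-- The number of bosons is constant on a sector and the mass of a sector is conserved. Any finite
set of configurations is enlarged to a union of whole sectors. -/
theorem FiniteSecondMoment.evolve [NeZero L] {H : Operator d L}
    (hH : ∀ N, (sectorMatrix H N).IsHermitian) (t : ℝ) {ψ : Config d L → ℂ}
    (hψ : FiniteSecondMoment ψ) : FiniteSecondMoment (evolve H t ψ) := by
  have hsector : ∀ (φ : Config d L → ℂ) (N : ℕ),
      ∑ η ∈ Finset.piAntidiag (Finset.univ : Finset (Torus d L)) N,
        ((∑ x, η x : ℕ) : ℝ) ^ 2 * ‖φ η‖ ^ 2 =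
      (N : ℝ) ^ 2 * ∑ η ∈ Finset.piAntidiag (Finset.univ : Finset (Torus d L)) N, ‖φ η‖ ^ 2 :=
    fun φ N => by
      rw [Finset.mul_sum]
      refine Finset.sum_congr rfl fun η hη => ?_
      rw [(Finset.mem_piAntidiag.mp hη).1]
  refine summable_of_sum_le (fun η => by positivity) (c := ∑' η : Config d L,
    ((∑ x, η x : ℕ) : ℝ) ^ 2 * ‖ψ η‖ ^ 2) fun u => ?_
  set s := u.image fun η : Config d L => ∑ x, η x with hs
  have hdisj : (s : Set ℕ).PairwiseDisjoint
      fun N => Finset.piAntidiag (Finset.univ : Finset (Torus d L)) N := fun M _ N _ hMN =>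
    Finset.disjoint_left.mpr fun η h1 h2 =>
      hMN ((Finset.mem_piAntidiag.mp h1).1.symm.trans (Finset.mem_piAntidiag.mp h2).1)
  have hsub : u ⊆ s.biUnion fun N => Finset.piAntidiag (Finset.univ : Finset (Torus d L)) N :=
    fun η hη => Finset.mem_biUnion.mpr ⟨∑ x, η x, Finset.mem_image_of_mem _ hη, by simp⟩
  refine (Finset.sum_le_sum_of_subset_of_nonneg hsub fun η _ _ => by positivity).trans ?_
  rw [Finset.sum_biUnion hdisj]
  simp only [hsector, sum_sector_norm_sq_evolve hH]
  simp only [← hsector]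
  rw [← Finset.sum_biUnion hdisj]
  exact hψ.sum_le_tsum _ fun η _ => by positivity

theorem InDomain.finiteSecondMoment [NeZero L] {ψ : FockSpace d L}
    (h : InDomain (totalNumber d L) ψ) : FiniteSecondMoment (ψ : Config d L → ℂ) := by
  have := (memℓp_gen_iff (by norm_num)).mp h
  refine this.congr fun η => ?_
  rw [totalNumber_apply, norm_mul, Complex.norm_natCast]
  norm_num [mul_pow]

end Evolution

/-! ### Consequences of translation invariance of the state. -/

section Invariance

variable {d L : ℕ} {ψ : Config d L → ℂ}

/-- Invariance of a coefficient function under all translations, up to phases. -/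
def IsShiftInvariant (ψ : Config d L → ℂ) : Prop :=
  ∀ z : Torus d L, ∃ c : ℂ, ‖c‖ = 1 ∧ ∀ η, ψ (shift z η) = c * ψ η

theorem IsTranslationInvariantState.evolve [NeZero L] {H : Operator d L}
    (hH : IsTranslationInvariantOp H) (t : ℝ) {φ : FockSpace d L}
    (hφ : IsTranslationInvariantState φ) : IsShiftInvariant (evolve H t φ) := fun z => by
  obtain ⟨c, hc, h⟩ := hφ z
  exact ⟨c, hc, hH.evolve_shift t h⟩

theorem IsShiftInvariant.tsum_shift (hψ : IsShiftInvariant ψ) (z : Torus d L)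
    (f : Config d L → ℝ) : ∑' η, f (shift z η) * ‖ψ η‖ ^ 2 = ∑' η, f η * ‖ψ η‖ ^ 2 := by
  obtain ⟨c, hc, h⟩ := hψ z
  rw [← (shift z).tsum_eq fun η => f η * ‖ψ η‖ ^ 2]
  refine tsum_congr fun η => ?_
  rw [h, norm_mul, hc, one_mul]

theorem IsShiftInvariant.tsum_comp_eq (hψ : IsShiftInvariant ψ) (f : ℕ → ℝ) (x y : Torus d L) :
    ∑' η : Config d L, f (η x) * ‖ψ η‖ ^ 2 = ∑' η : Config d L, f (η y) * ‖ψ η‖ ^ 2 := by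
  rw [← hψ.tsum_shift (x - y)]
  simp only [shift_apply, sub_sub_cancel]

/-- From `2 n_0 n_x ≤ n_0² + n_x²` and `⟨n_x²⟩ = ⟨n_0²⟩`. -/
theorem IsShiftInvariant.pairMoment_le [NeZero L] (hψ : IsShiftInvariant ψ)
    (h2 : FiniteSecondMoment ψ) (x : Torus d L) : pairMoment ψ x ≤ pairMoment ψ 0 := by
  have h := hψ.tsum_comp_eq (fun n => (n * n : ℝ)) x 0
  have hx := (h2.summable_mul x x).hasSum
  rw [h] at hx
  have h0 := (h2.summable_mul 0 0).hasSum
  have hs := (h0.add hx).mul_left (1 / 2)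
  have e : pairMoment ψ 0 = _ := (by rw [pairMoment]; ring : _ = _).trans hs.tsum_eq.symm
  rw [e]
  refine (h2.summable_mul 0 x).tsum_le_tsum (fun η => ?_) hs.summable
  have h3 := two_mul_le_add_sq (η 0 : ℝ) (η x : ℝ)
  have h4 := mul_le_mul_of_nonneg_right h3 (sq_nonneg ‖ψ η‖)
  linarith

theorem IsShiftInvariant.hopMoment_eq (hψ : IsShiftInvariant ψ) (x y z : Torus d L) :
    hopMoment ψ x y z = hopMoment ψ (x - z) (y - z) 0 := by
  obtain ⟨c, hc, h⟩ := hψ z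
  rw [hopMoment, ← (shift z).tsum_eq]
  refine tsum_congr fun ζ => ?_
  have hcc : conj c * c = 1 := by
    rw [Complex.conj_mul', hc]
    norm_num
  have hw : hopWeight x y z (shift z ζ) = hopWeight (x - z) (y - z) 0 ζ := by
    rw [hopWeight, ← shift_add_single, ← shift_add_single, shift_apply, shift_apply, sub_self,
      hopWeight]
  rw [hw, hopTerm, ← shift_add_single, ← shift_add_single, h, h, hopTerm, shift_apply, shift_apply,
    map_mul]
  linear_combination (conj (ψ (ζ + Pi.single (x - z) 1)) *
    ((Real.sqrt (ζ (x - z) + 1) * Real.sqrt (ζ (y - z) + 1) : ℝ) *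
      ψ (ζ + Pi.single (y - z) 1)) * (hopWeight (x - z) (y - z) 0 ζ : ℂ)) * hcc

/-- For an even weight, translation invariance exchanges the roles of the two densities. -/
theorem IsShiftInvariant.sum_hop_swap [NeZero L] (hψ : IsShiftInvariant ψ)
    {J : Matrix (Torus d L) (Torus d L) ℝ} {Φ : Config d L → ℝ}
    (hO : IsTranslationInvariantOp (hamiltonian J Φ)) {g : Torus d L → ℝ}
    (hg : ∀ x, g (-x) = g x) :
    ∑ x, ∑ y, (J x y : ℂ) *
      (((((Pi.single y 1 : Config d L) 0 : ℝ) - ((Pi.single x 1 : Config d L) 0 : ℝ) : ℝ) : ℂ) *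
        ∑ z, (g z : ℂ) * hopMoment ψ x y z) =
    ∑ x, ∑ y, (J x y : ℂ) * (((g y - g x : ℝ) : ℂ) * hopMoment ψ x y 0) := by
  set D : Torus d L → Torus d L → ℂ := fun x y =>
    ((((Pi.single y 1 : Config d L) 0 : ℝ) - ((Pi.single x 1 : Config d L) 0 : ℝ) : ℝ) : ℂ) with hD
  have hterm : ∀ x y z : Torus d L, (J x y : ℂ) * (D x y * ((g z : ℂ) * hopMoment ψ x y z)) =
      (J (x - z) (y - z) : ℂ) * (D (x - z + z) (y - z + z) *
        ((g z : ℂ) * hopMoment ψ (x - z) (y - z) 0)) := fun x y z => by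
    rw [sub_add_cancel, sub_add_cancel, ← hψ.hopMoment_eq]
    -- On the diagonal the factor `D` vanishes, so invariance of `J` is needed only off it.
    by_cases h : x = y
    · subst h
      simp [hD]
    · rw [hO.hopping_sub h]
  -- The indicators of the origin select `z = -y` and `z = -x`; evenness of `g` turns the result
  -- into the increment of `g`.
  have hsum : ∀ x y : Torus d L, ∑ z, D (x + z) (y + z) * (g z : ℂ) = ((g y - g x : ℝ) : ℂ) :=
    fun x y => by
      have h1 : ∀ u : Torus d L,
          ∑ z, (((Pi.single (u + z) 1 : Config d L) 0 : ℝ) : ℂ) * (g z : ℂ) = g u := fun u => by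
        rw [Finset.sum_eq_single (-u)]
        · simp [hg]
        · intro z _ hz
          have : (0 : Torus d L) ≠ u + z := fun h => hz (eq_neg_of_add_eq_zero_right h.symm)
          simp [Pi.single_eq_of_ne this]
        · simp
      simp only [hD, Complex.ofReal_sub, sub_mul, Finset.sum_sub_distrib]
      rw [h1, h1]
  calc ∑ x, ∑ y, (J x y : ℂ) * (D x y * ∑ z, (g z : ℂ) * hopMoment ψ x y z)
      = ∑ x, ∑ y, ∑ z, (J x y : ℂ) * (D x y * ((g z : ℂ) * hopMoment ψ x y z)) := by
        simp only [Finset.mul_sum]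
    _ = ∑ z, ∑ x, ∑ y, (J x y : ℂ) * (D x y * ((g z : ℂ) * hopMoment ψ x y z)) := by
        exact (Finset.sum_congr rfl fun x _ => Finset.sum_comm).trans Finset.sum_comm
    _ = ∑ z, ∑ x, ∑ y, (J x y : ℂ) * (D (x + z) (y + z) *
          ((g z : ℂ) * hopMoment ψ x y 0)) := by
        refine Finset.sum_congr rfl fun z _ => ?_
        simp only [hterm]
        rw [← Equiv.sum_comp (Equiv.subRight z) (fun x => ∑ y, (J x y : ℂ) * (D (x + z) (y + z) *
          ((g z : ℂ) * hopMoment ψ x y 0)))]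
        refine Finset.sum_congr rfl fun x _ => ?_
        exact Equiv.sum_comp (Equiv.subRight z) (fun y => (J (x - z) y : ℂ) *
          (D (x - z + z) (y + z) * ((g z : ℂ) * hopMoment ψ (x - z) y 0)))
    _ = ∑ x, ∑ y, (J x y : ℂ) * (((g y - g x : ℝ) : ℂ) * hopMoment ψ x y 0) := by
        rw [Finset.sum_comm]
        refine Finset.sum_congr rfl fun x _ => ?_
        rw [Finset.sum_comm]
        refine Finset.sum_congr rfl fun y _ => ?_
        rw [← hsum, Finset.sum_mul, Finset.mul_sum]
        exact Finset.sum_congr rfl fun z _ => by ring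

theorem IsShiftInvariant.hasSum_lie [NeZero L] (hψ : IsShiftInvariant ψ)
    (h2 : FiniteSecondMoment ψ) {J : Matrix (Torus d L) (Torus d L) ℝ} {Φ : Config d L → ℝ}
    (hO : IsTranslationInvariantOp (hamiltonian J Φ)) {g : Torus d L → ℝ}
    (hg : ∀ x, g (-x) = g x) :
    HasSum (fun η => conj (ψ η) * ⁅Complex.I • hamiltonian J Φ, correlation g⁆ ψ η)
      (Complex.I * ∑ x, ∑ y, (J x y : ℂ) * (((g y - g x : ℝ) : ℂ) * hopMoment ψ x y 0)) := by
  have h := h2.hasSum_lie J Φ g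
  simp only [mul_left_comm _ (1 / 2 : ℂ), ← Finset.mul_sum] at h
  simp only [mul_add (_ : ℂ) (_ * hopMoment ψ _ _ 0), Finset.sum_add_distrib] at h
  -- The two contributions are equal, which cancels the factor `1 / 2`.
  rw [hψ.sum_hop_swap hO hg, ← two_mul, ← mul_assoc (1 / 2 : ℂ)] at h
  convert h using 1
  ring

theorem FiniteSecondMoment.hasSum_correlation [NeZero L] (h2 : FiniteSecondMoment ψ)
    (g : Torus d L → ℝ) :
    HasSum (fun η => conj (ψ η) * correlation g ψ η)
      ((∑ x, g x * pairMoment ψ x : ℝ) : ℂ) := by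
  have h := hasSum_sum (s := Finset.univ) fun x _ => (h2.summable_mul 0 x).hasSum.mul_left (g x)
  refine Eq.mpr (congrArg (fun f => HasSum f _) (funext fun η => ?_)) (Complex.hasSum_ofReal.mpr h)
  rw [correlation_apply, mul_left_comm, Complex.conj_mul', ← Complex.ofReal_pow,
    ← Complex.ofReal_mul, correlationValue, Finset.mul_sum, Finset.sum_mul]
  congr 1
  exact Finset.sum_congr rfl fun x _ => by ring

theorem FiniteSecondMoment.hasSum_number_sq [NeZero L] (h2 : FiniteSecondMoment ψ) :
    HasSum (fun η => conj (ψ η) * (number 0 ^ 2 : Operator d L) ψ η) (pairMoment ψ 0 : ℂ) := by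
  refine Eq.mpr (congrArg (fun f => HasSum f _) (funext fun η => ?_))
    (Complex.hasSum_ofReal.mpr (h2.summable_mul 0 0).hasSum)
  rw [pow_two, Module.End.mul_apply, number_apply, number_apply]
  push_cast
  rw [← Complex.conj_mul']
  ring

end Invariance

/-! ### Summation of the hopping across the front. -/

section Hopping

theorem exists_sum_sq_mul_rpow_le (d : ℕ) {α : ℝ} (hα : 3 * (d : ℝ) + 1 < α) :
    ∃ C : ℝ, 0 ≤ C ∧ ∀ (L : ℕ) [NeZero L],
      ∑ x : Torus d L, siteNorm x ^ 2 * (1 + siteNorm x) ^ (-α) ≤ C := by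
  -- For `d ≥ 1` the hypothesis gives `α - 2 > d`; for `d = 0` this may fail, but there every
  -- distance is zero.
  rcases Nat.eq_zero_or_pos d with rfl | hd
  · exact ⟨0, le_rfl, fun L _ => Finset.sum_nonpos fun x _ => by simp [siteNorm]⟩
  have hd' : (1 : ℝ) ≤ d := by exact_mod_cast hd
  obtain ⟨C, hC, h⟩ := exists_sum_rpow_tail_le d (γ := α - 2) (by linarith)
  refine ⟨C, hC, fun L _ => ?_⟩
  have h1 := h L 1 one_pos
  rw [Finset.filter_true_of_mem fun x _ => by linarith [siteNorm_nonneg x], Real.one_rpow,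
    mul_one] at h1
  refine le_trans (Finset.sum_le_sum fun x _ => ?_) h1
  have hx := siteNorm_nonneg x
  have e : (1 + siteNorm x) ^ (-(α - 2)) = (1 + siteNorm x) ^ 2 * (1 + siteNorm x) ^ (-α) := by
    rw [← Real.rpow_natCast, ← Real.rpow_add (by positivity)]
    congr 1
    push_cast
    ring
  rw [e]
  gcongr
  linarith

variable {d L : ℕ} [NeZero L]

theorem sum_mul_hopping_le {J : Matrix (Torus d L) (Torus d L) ℝ} {CJ α : ℝ}
    (hJ : ∀ x y, |J x y| ≤ CJ * (1 + siteNorm (x - y)) ^ (-α)) {f : Torus d L → ℝ}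
    (hf : ∀ x, 0 ≤ f x) (x : Torus d L) :
    ∑ y, |J x y| * f (x - y) ≤ |CJ| * ∑ z, f z * (1 + siteNorm z) ^ (-α) := by
  rw [← Equiv.sum_comp (Equiv.subLeft x), Finset.mul_sum]
  refine Finset.sum_le_sum fun y _ => ?_
  have h1 := siteNorm_nonneg y
  have h2 := hJ x (x - y)
  simp only [Equiv.subLeft_apply, sub_sub_cancel] at h2 ⊢
  calc |J x (x - y)| * f y ≤ |CJ| * (1 + siteNorm y) ^ (-α) * f y :=
        mul_le_mul_of_nonneg_right (h2.trans
          (mul_le_mul_of_nonneg_right (le_abs_self CJ) (by positivity))) (hf _)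
    _ = _ := by ring

theorem sum_hopping_le_kappa (J : Matrix (Torus d L) (Torus d L) ℝ) (x : Torus d L) :
    ∑ y, |J x y| * siteNorm (x - y) ≤ kappa J :=
  le_ciSup (f := fun x => ∑ y, |J x y| * siteNorm (x - y)) (Set.finite_range _).bddAbove x

theorem kappa_nonneg (J : Matrix (Torus d L) (Torus d L) ℝ) : 0 ≤ kappa J :=
  (Finset.sum_nonneg fun _ _ => mul_nonneg (abs_nonneg _) (siteNorm_nonneg _)).trans
    (sum_hopping_le_kappa J 0)

/-- The transport estimate for a front of width `s`: the near part of the hopping is expanded to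
first order, the far part is estimated by the number of sites inside the front. -/
theorem sum_hopping_front_le {J : Matrix (Torus d L) (Torus d L) ℝ} (hJ : J.IsSymm)
    {ε : ℝ} (hε : 0 < ε) {χ χ₂ : ℝ → ℝ} (hχ : IsCutoff ε χ) (hχ₂ : IsCutoff ε χ₂) {M δ : ℝ}
    (hM : 0 ≤ M) (hexp : ∀ a b : ℝ, |b - a| < δ →
      |χ b - χ a| ≤ deriv χ a * |b - a| + M * deriv χ₂ a * |b - a| ^ 2)
    {p : Torus d L → ℝ} (hp : ∀ x, 0 ≤ p x) (hp0 : ∀ x, p x ≤ p 0) {M₂ F R w s t : ℝ}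
    (hM₂ : ∀ x, ∑ y, |J x y| * siteNorm (x - y) ^ 2 ≤ M₂)
    (hF : ∀ x, ∑ y, |J x y| * (if δ * s ≤ siteNorm (x - y) then 1 else 0) ≤ F)
    (hs : 0 < s) (hR : 1 ≤ R) (hwt : 0 ≤ w * t) :
    ∑ x, ∑ y, |J x y| * |scaled χ R w s t y - scaled χ R w s t x| * (p x + p y) ≤
      2 * kappa J / s * ∑ x : Torus d L, scaled (deriv χ) R w s t x * p x +
      2 * M * M₂ / s ^ 2 * ∑ x : Torus d L, scaled (deriv χ₂) R w s t x * p x +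
      4 * (4 * R) ^ d * F * p 0 := by
  set g : Torus d L → ℝ := scaled χ R w s t with hg
  set a : Torus d L → ℝ := fun x => (R - w * t - siteNorm x) / s with ha
  -- Indicator of the ball of radius `R`, outside which `g` vanishes because `w * t ≥ 0`.
  set ind : Torus d L → ℝ := fun x => if 1 + siteNorm x < 1 + R then 1 else 0 with hind
  set far : Torus d L → Torus d L → ℝ :=
    fun x y => |J x y| * (if δ * s ≤ siteNorm (x - y) then 1 else 0) with hfar
  have hind0 : ∀ x, 0 ≤ ind x := fun x => by
    simp only [hind]
    split_ifs <;> norm_num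
  have hfar0 : ∀ x y, 0 ≤ far x y := fun x y => by
    simp only [hfar]
    split_ifs <;> positivity
  have hfar_comm : ∀ x y, far x y = far y x := fun x y => by
    simp only [hfar]
    rw [hJ.apply, siteNorm_sub_comm]
  have hgind : ∀ x, g x ≤ ind x := fun x => by
    simp only [hind]
    split_ifs with h
    · exact hχ.le_one _
    · refine (hχ.eq_zero _ ?_).le
      have : (R - w * t - siteNorm x) / s ≤ 0 :=
        div_nonpos_of_nonpos_of_nonneg (by linarith) hs.le
      linarith
  have hg0 : ∀ x, 0 ≤ g x := fun x => hχ.nonneg _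
  have hF0 : 0 ≤ F := (Finset.sum_nonneg fun y _ => hfar0 0 y).trans (hF 0)
  have hpoint : ∀ x y, |J x y| * |g y - g x| * p x ≤
      deriv χ (a x) * p x / s * (|J x y| * siteNorm (x - y)) +
      M * (deriv χ₂ (a x) * p x) / s ^ 2 * (|J x y| * siteNorm (x - y) ^ 2) +
      far x y * (ind x + ind y) * p 0 := fun x y => by
    have h1 := hχ.deriv_nonneg (a x)
    have h2 := hχ₂.deriv_nonneg (a x)
    have h3 := siteNorm_nonneg (x - y)
    have h4 := hp x
    have h5 := hp 0
    have h6 := hind0 x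
    have h7 := hind0 y
    have h8 := hfar0 x y
    by_cases hxy : δ * s ≤ siteNorm (x - y)
    · have h9 : far x y = |J x y| := by simp [hfar, hxy]
      have h10 : |g y - g x| ≤ ind x + ind y := by
        rw [abs_le]
        constructor <;> linarith [hgind x, hgind y, hg0 x, hg0 y]
      have h11 : |J x y| * |g y - g x| * p x ≤ far x y * (ind x + ind y) * p 0 := by
        rw [h9]
        exact mul_le_mul (mul_le_mul_of_nonneg_left h10 (abs_nonneg _)) (hp0 x) h4
          (by positivity)
      refine h11.trans (le_add_of_nonneg_left ?_)
      positivity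
    · have h9 : |a y - a x| ≤ siteNorm (x - y) / s := by
        have : a y - a x = (siteNorm x - siteNorm y) / s := by
          simp only [ha]
          ring
        rw [this, abs_div, abs_of_pos hs]
        exact div_le_div_of_nonneg_right (abs_siteNorm_sub_le x y) hs.le
      have h10 : |g y - g x| ≤ deriv χ (a x) * (siteNorm (x - y) / s) +
          M * deriv χ₂ (a x) * (siteNorm (x - y) / s) ^ 2 := by
        refine (hexp (a x) (a y) (h9.trans_lt ?_)).trans ?_
        · rw [div_lt_iff₀ hs]
          exact not_le.mp hxy
        · gcongr
      have h11 := mul_le_mul_of_nonneg_right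
        (mul_le_mul_of_nonneg_left h10 (abs_nonneg (J x y))) h4
      refine h11.trans (le_trans (le_of_eq ?_) (le_add_of_nonneg_right (by positivity)))
      field_simp
  -- Symmetry of `J` lets the derivative be taken at the site carrying the density, at the cost of
  -- the factor 2 in `2 * kappa J`.
  have hsymm : ∑ x, ∑ y, |J x y| * |g y - g x| * (p x + p y) =
      2 * ∑ x, ∑ y, |J x y| * |g y - g x| * p x := by
    simp only [mul_add, Finset.sum_add_distrib]
    rw [two_mul, Finset.sum_comm (f := fun x y => |J x y| * |g y - g x| * p y)]
    congr 1
    refine Finset.sum_congr rfl fun x _ => Finset.sum_congr rfl fun y _ => ?_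
    rw [hJ.apply, abs_sub_comm]
  have hfar_sum : ∑ x, ∑ y, far x y * (ind x + ind y) * p 0 ≤ 2 * (4 * R) ^ d * F * p 0 := by
    have h1 : ∑ x, ∑ y, far x y * (ind x + ind y) * p 0 =
        2 * (∑ x, ind x * ∑ y, far x y) * p 0 := by
      simp only [mul_add, add_mul, Finset.sum_add_distrib]
      rw [Finset.sum_comm (f := fun x y => far x y * ind y * p 0)]
      simp only [Finset.mul_sum, Finset.sum_mul, ← Finset.sum_add_distrib]
      refine Finset.sum_congr rfl fun x _ => Finset.sum_congr rfl fun y _ => ?_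
      rw [hfar_comm y x]
      ring
    have h2 : ∑ x, ind x ≤ (4 * R) ^ d := by
      have h3 := card_siteNorm_lt (d := d) (L := L) (S := 1 + R) (by linarith)
      simp only [hind, Finset.sum_boole]
      exact h3.trans (pow_le_pow_left₀ (by linarith) (by linarith) d)
    have h3 : ∑ x, ind x * ∑ y, far x y ≤ (4 * R) ^ d * F := by
      calc ∑ x, ind x * ∑ y, far x y ≤ ∑ x, ind x * F :=
            Finset.sum_le_sum fun x _ => mul_le_mul_of_nonneg_left (hF x) (hind0 x)
        _ = (∑ x, ind x) * F := by rw [Finset.sum_mul]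
        _ ≤ _ := mul_le_mul_of_nonneg_right h2 hF0
    rw [h1, mul_assoc 2 ((4 * R) ^ d)]
    exact mul_le_mul_of_nonneg_right (mul_le_mul_of_nonneg_left h3 zero_le_two) (hp 0)
  have hnear₁ : ∑ x, ∑ y, deriv χ (a x) * p x / s * (|J x y| * siteNorm (x - y)) ≤
      kappa J / s * ∑ x, deriv χ (a x) * p x := by
    rw [Finset.mul_sum]
    refine Finset.sum_le_sum fun x _ => ?_
    rw [← Finset.mul_sum]
    have h1 := mul_nonneg (hχ.deriv_nonneg (a x)) (hp x)
    calc _ ≤ deriv χ (a x) * p x / s * kappa J :=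
          mul_le_mul_of_nonneg_left (sum_hopping_le_kappa J x) (by positivity)
      _ = _ := by ring
  have hnear₂ : ∑ x, ∑ y, M * (deriv χ₂ (a x) * p x) / s ^ 2 *
      (|J x y| * siteNorm (x - y) ^ 2) ≤ M * M₂ / s ^ 2 * ∑ x, deriv χ₂ (a x) * p x := by
    rw [Finset.mul_sum]
    refine Finset.sum_le_sum fun x _ => ?_
    rw [← Finset.mul_sum]
    have h1 := mul_nonneg (hχ₂.deriv_nonneg (a x)) (hp x)
    calc _ ≤ M * (deriv χ₂ (a x) * p x) / s ^ 2 * M₂ :=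
          mul_le_mul_of_nonneg_left (hM₂ x) (by positivity)
      _ = _ := by ring
  have hall := Finset.sum_le_sum fun x (_ : x ∈ (Finset.univ : Finset (Torus d L))) =>
    Finset.sum_le_sum fun y (_ : y ∈ (Finset.univ : Finset (Torus d L))) => hpoint x y
  simp only [Finset.sum_add_distrib] at hall
  rw [hsymm]
  change _ ≤ 2 * kappa J / s * ∑ x, deriv χ (a x) * p x +
    2 * M * M₂ / s ^ 2 * ∑ x, deriv χ₂ (a x) * p x + _
  have e₁ : 2 * kappa J / s = 2 * (kappa J / s) := by ring
  have e₂ : 2 * M * M₂ / s ^ 2 = 2 * (M * M₂ / s ^ 2) := by ring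
  rw [e₁, e₂]
  linarith

end Hopping

/-! ### The Heisenberg derivative and the final estimate. -/

theorem deriv_scaled {d L : ℕ} {χ : ℝ → ℝ} (hχ : Differentiable ℝ χ) (R w s t : ℝ) (x : Torus d L) :
    deriv (fun τ => scaled χ R w s τ x) t = -(w / s) * scaled (deriv χ) R w s t x := by
  have h1 : HasDerivAt (fun τ => (R - w * τ - siteNorm x) / s) (-(w / s)) t := by
    have := ((((hasDerivAt_id t).const_mul w).const_sub R).sub_const (siteNorm x)).div_const s
    rw [mul_one, neg_div] at this
    exact this
  have h2 := (hχ ((R - w * t - siteNorm x) / s)).hasDerivAt.comp t h1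
  rw [mul_comm]
  exact h2.deriv

/-- The Heisenberg derivative is controlled by the hopping across the front. -/
theorem re_expectation_heisenbergDeriv_le {d L : ℕ} [NeZero L]
    {J : Matrix (Torus d L) (Torus d L) ℝ} {Φ : Config d L → ℝ}
    (hO : IsTranslationInvariantOp (hamiltonian J Φ)) {ψ : Config d L → ℂ}
    (hψ : IsShiftInvariant ψ) (h2 : FiniteSecondMoment ψ) {χ : ℝ → ℝ} (hχ : Differentiable ℝ χ)
    (R w s t : ℝ) :
    HasExpectation ψ (heisenbergDeriv (hamiltonian J Φ) χ R w s t) ∧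
    (expectation ψ (heisenbergDeriv (hamiltonian J Φ) χ R w s t)).re ≤
      -(w / s) * ∑ x : Torus d L, scaled (deriv χ) R w s t x * pairMoment ψ x +
      ∑ x, ∑ y, |J x y| * |scaled χ R w s t y - scaled χ R w s t x| *
        (pairMoment ψ x + pairMoment ψ y) := by
  set g : Torus d L → ℝ := scaled χ R w s t with hg
  have heven : ∀ x, g (-x) = g x := fun x => by simp only [hg, scaled, siteNorm_neg]
  have h := (h2.hasSum_correlation fun x => deriv (fun τ => scaled χ R w s τ x) t).add
    (hψ.hasSum_lie h2 hO heven)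
  simp only [← mul_add] at h
  have hH : HasSum (fun η => conj (ψ η) * heisenbergDeriv (hamiltonian J Φ) χ R w s t ψ η) _ := h
  refine ⟨hH.summable, ?_⟩
  rw [expectation, hH.tsum_eq, Complex.add_re, Complex.ofReal_re]
  refine add_le_add (le_of_eq ?_) ?_
  · simp only [deriv_scaled hχ, Finset.mul_sum, mul_assoc]
  · refine (Complex.re_le_norm _).trans ?_
    rw [norm_mul, Complex.norm_I, one_mul]
    refine (norm_sum_le _ _).trans (Finset.sum_le_sum fun x _ => (norm_sum_le _ _).trans
      (Finset.sum_le_sum fun y _ => ?_))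
    rw [norm_mul, norm_mul, Complex.norm_real, Complex.norm_real, Real.norm_eq_abs,
      Real.norm_eq_abs, mul_assoc]
    gcongr
    exact h2.norm_hopMoment_le (hψ.tsum_comp_eq (fun n => (n : ℝ))) x y

end BoseHubbard

theorem mainTheorem3 (d : ℕ) (α : ℝ) (hα : 3 * (d : ℝ) + 1 < α) (CJ ε : ℝ) (hε : 0 < ε)
    (χ : ℝ → ℝ) (hχ : IsCutoff ε χ) :
    ∃ C : ℝ, 0 < C ∧ ∃ χ₂ : ℝ → ℝ, IsCutoff ε χ₂ ∧
      ∀ (L : ℕ) [NeZero L] (J : Matrix (Torus d L) (Torus d L) ℝ) (Φ : Config d L → ℝ),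
        J.IsSymm →
        IsTranslationInvariantOp (hamiltonian J Φ) →
        (∀ x y, |J x y| ≤ CJ * (1 + siteNorm (x - y)) ^ (-α)) →
        ∀ v w : ℝ, 2 * kappa J < v → w = (kappa J + v) / 2 → v - w = ε →
        ∀ ψ₀ : FockSpace d L, IsAdmissibleState (hamiltonian J Φ) ψ₀ →
        ∀ r R s : ℝ, 0 < r → r < R → max v 1 < R - r → s = (R - r) / v →
        ∀ t : ℝ, 0 ≤ t → ∀ ψ : Config d L → ℂ, ψ = evolve (hamiltonian J Φ) t ψ₀ →
          HasExpectation ψ (heisenbergDeriv (hamiltonian J Φ) χ R w s t) ∧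
          HasExpectation ψ (astloPrime χ R w s t) ∧
          HasExpectation ψ (astloPrime χ₂ R w s t) ∧
          HasExpectation ψ (number 0 ^ 2) ∧
          (expectation ψ (heisenbergDeriv (hamiltonian J Φ) χ R w s t)).re ≤
            (2 * kappa J - w) / s * (expectation ψ (astloPrime χ R w s t)).re +
            C / s ^ 2 * (expectation ψ (astloPrime χ₂ R w s t)).re +
            C / s ^ (⌊α - d - 1⌋₊ + 1) * R ^ d * (expectation ψ (number 0 ^ 2)).re := by
  obtain ⟨χ₂, hχ₂, M, hM, δ, hδ, hexp⟩ := hχ.exists_abs_sub_le hε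
  have hd0 : (0 : ℝ) ≤ d := Nat.cast_nonneg d
  obtain ⟨C₂, hC₂, hmom⟩ := exists_sum_sq_mul_rpow_le d hα
  obtain ⟨C₃, hC₃, htail⟩ := exists_sum_rpow_tail_le d (γ := α) (by linarith)
  -- `A` comes from the quadratic error, `B` from the long hops; the added 1 only ensures a positive
  -- constant.
  set A : ℝ := 2 * M * (|CJ| * C₂) with hA
  set B : ℝ := 4 * 4 ^ d * (|CJ| * (C₃ * δ ^ ((d : ℝ) - α))) with hB
  have hA0 : 0 ≤ A := by positivity
  have hB0 : 0 ≤ B := by positivity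
  refine ⟨A + B + 1, by positivity, χ₂, hχ₂, ?_⟩
  rintro L _ J Φ hJ hO hdecay v w hv hw - ψ₀ hψ₀ r R s hr hrR hRr hs t ht ψ rfl
  set ψ := evolve (hamiltonian J Φ) t ψ₀ with hψdef
  have hκ := kappa_nonneg J
  have hv0 : 0 < v := by linarith
  have hvR : v < R - r := (le_max_left _ _).trans_lt hRr
  have h1R : 1 < R - r := (le_max_right _ _).trans_lt hRr
  have hs1 : 1 ≤ s := by
    rw [hs, le_div_iff₀ hv0]
    linarith
  have hs0 : 0 < s := by linarith
  have hwt : 0 ≤ w * t := mul_nonneg (by linarith) ht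
  have hψ : IsShiftInvariant ψ := hψ₀.translation_invariant.evolve hO t
  have h2 : FiniteSecondMoment ψ := FiniteSecondMoment.evolve
    (sectorMatrix_hamiltonian_isHermitian hJ Φ) t hψ₀.mem_domain_number.finiteSecondMoment
  obtain ⟨hexp₁, hle⟩ := re_expectation_heisenbergDeriv_le hO hψ h2
    (hχ.smooth.differentiable (by simp)) R w s t
  have hcor := fun f : ℝ → ℝ => h2.hasSum_correlation (scaled f R w s t)
  have hnum := h2.hasSum_number_sq
  refine ⟨hexp₁, (hcor (deriv χ)).summable, (hcor (deriv χ₂)).summable, hnum.summable, ?_⟩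
  have e₁ : ∀ f : ℝ → ℝ, (expectation ψ (astloPrime f R w s t)).re =
      ∑ x : Torus d L, scaled (deriv f) R w s t x * pairMoment ψ x := fun f => by
    rw [expectation, astloPrime, (hcor (deriv f)).tsum_eq, Complex.ofReal_re]
  have e₂ : (expectation ψ (number 0 ^ 2)).re = pairMoment ψ 0 := by
    rw [expectation, hnum.tsum_eq, Complex.ofReal_re]
  have hM₂ : ∀ x, ∑ y, |J x y| * siteNorm (x - y) ^ 2 ≤ |CJ| * C₂ := fun x =>
    (sum_mul_hopping_le hdecay (f := fun z => siteNorm z ^ 2) (fun z => sq_nonneg _) x).trans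
      (mul_le_mul_of_nonneg_left (hmom L) (abs_nonneg _))
  have hF : ∀ x, ∑ y, |J x y| * (if δ * s ≤ siteNorm (x - y) then 1 else 0) ≤
      |CJ| * (C₃ * (δ * s) ^ ((d : ℝ) - α)) := fun x => by
    refine (sum_mul_hopping_le hdecay (f := fun z => if δ * s ≤ siteNorm z then 1 else 0)
      (fun z => by positivity) x).trans (mul_le_mul_of_nonneg_left
        (le_trans ?_ (htail L (δ * s) (by positivity))) (abs_nonneg _))
    rw [Finset.sum_filter]
    refine Finset.sum_le_sum fun z _ => ?_
    have hz := siteNorm_nonneg z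
    have hz' : 0 ≤ (1 + siteNorm z) ^ (-α) := by positivity
    split_ifs with h3 h4 h4
    · rw [one_mul]
    · linarith
    · simpa using hz'
    · simp
  have hfront := sum_hopping_front_le hJ hε hχ hχ₂ hM hexp (pairMoment_nonneg ψ)
    (hψ.pairMoment_le h2) hM₂ hF hs0 (R := R) (by linarith) hwt
  -- Here `⌊α - d - 1⌋₊ + 1 ≤ α - d` and `s ≥ 1`, the latter because `R - r > v`.
  have hpow : s ^ ((d : ℝ) - α) ≤ 1 / s ^ (⌊α - d - 1⌋₊ + 1) := by
    rw [one_div, ← Real.rpow_natCast, ← Real.rpow_neg hs0.le]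
    refine Real.rpow_le_rpow_of_exponent_le hs1 ?_
    have := Nat.floor_le (show 0 ≤ α - d - 1 by linarith)
    push_cast
    linarith
  have hP := pairMoment_nonneg ψ (0 : Torus d L)
  have hS : 0 ≤ ∑ x : Torus d L, scaled (deriv χ₂) R w s t x * pairMoment ψ x :=
    Finset.sum_nonneg fun x _ => mul_nonneg (hχ₂.deriv_nonneg _) (pairMoment_nonneg ψ x)
  have hR0 : 0 ≤ R := by linarith
  have hfar : 4 * (4 * R) ^ d * (|CJ| * (C₃ * (δ * s) ^ ((d : ℝ) - α))) * pairMoment ψ 0 ≤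
      (A + B + 1) / s ^ (⌊α - d - 1⌋₊ + 1) * R ^ d * pairMoment ψ 0 := by
    rw [Real.mul_rpow hδ.le hs0.le]
    have e : 4 * (4 * R) ^ d * (|CJ| * (C₃ * (δ ^ ((d : ℝ) - α) * s ^ ((d : ℝ) - α)))) =
        B * s ^ ((d : ℝ) - α) * R ^ d := by
      rw [hB, mul_pow]
      ring
    rw [e, div_eq_mul_one_div (A + B + 1)]
    gcongr
    linarith
  have hnear : 2 * M * (|CJ| * C₂) / s ^ 2 *
      ∑ x : Torus d L, scaled (deriv χ₂) R w s t x * pairMoment ψ x ≤ (A + B + 1) / s ^ 2 *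
      ∑ x : Torus d L, scaled (deriv χ₂) R w s t x * pairMoment ψ x := by
    gcongr
    linarith
  rw [e₁, e₁, e₂]
  have e₃ : (2 * kappa J - w) / s = 2 * kappa J / s + -(w / s) := by ring
  rw [e₃, add_mul]
  linarith
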